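/- Let $n\ge 1$, let $Q$ be a finite-dimensional smooth manifold with a Riemannian metric, $\pi:X\to Q$ a smooth vector bundle of finite rank, and $E:X\to Q$ a $C^1$ map. For $v,w$ in the same fibre of $X$ write $\mathbb{F}E_v(w)=\frac{d}{dt}\big|_{t=0}E(v+tw)\in T_{E(v)}Q$. For $0\le i\le n-1$ let $U_i\subset\mathbb{R}^{k_i}$ be a submanifold, $\mathcal{U}_i\subset U_i$ a convex set that is closed in $U_i$, and let $F_i:Q\times U_i\to Q$, $L_i:Q\times U_i\to\mathbb{R}$ and $\ell:Q\to\mathbb{R}$ be $C^1$. Assume that $F_i(q,u)=E(f_i(q,u))$ for $u\in\mathcal{U}_i$, where $f_i(q,u)\in X_q=\pi^{-1}(q)$ and $f_i(q,\cdot)$ is affine on $\mathcal{U}_i$ for each $q$, and that $L_i(q,\cdot)$ is convex on $\mathcal{U}_i$ for each $q$. Let $\varphi_1,\dots,\varphi_n:Q\to[0,\infty)$ be locally Lipschitz and fix $q_0\in Q$. A control sequence $u=(u_0,\dots,u_{n-1})$, $u_i\in\mathcal{U}_i$, determines states by $q_{i+1}=F_i(q_i,u_i)$ and has cost $J(u)=\ell(q_n)+\sum_{i=0}^{n-1}L_i(q_i,u_i)$.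 The Fréchet subdifferential $\partial_F\varphi(q)$ of $\varphi:Q\to\mathbb{R}$ is the set of all $dg(q)\in T_q^*Q$ with $g:Q\to\mathbb{R}$ of class $C^1$ such that $\varphi-g$ has a local minimum at $q$; the limiting subdifferential $\partial_L\varphi(q)$ is the set of all $p\in T_q^*Q$ for which there are $x_k\to q$ and $p_k\in\partial_F\varphi(x_k)$ with $\varphi(x_k)\to\varphi(q)$ and $p_k\to p$ in $T^*Q$. The set $\{\varphi=0\}$ is called $\varphi$-regular at one of its points $x_0$ if (a) there are $\varepsilon,\Delta>0$ such that $\|p\|\ge\Delta$ whenever $d(x,x_0)<\varepsilon$, $\varphi(x)>0$ and $p\in\partial_L\varphi(x)$, and (b) whenever $x_k\to x_0$ and $p_k\in\partial_L\varphi(x_k)$, some subsequence of $(p_k)$ converges to an element of $\partial_L\varphi(x_0)$. **Theorem.** Suppose that $u$ minimizes $J$ among all control sequences whose states satisfy $q_i\in S_i:=\{\varphi_i=0\}$ for $1\le i\le n$, and that $S_i$ is $\varphi_i$-regular at the state $q_i$ generated by $u$, for $1\le i\le n$. Then there are $\lambda_0\in\{0,1\}$, a number $\kappa>0$ (with $\kappa=1$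 if $\lambda_0=0$) and covectors $p_i\in T^*_{q_i}Q$, $1\le i\le n$, such that 1. $-p_n\in\lambda_0\,d\ell(q_n)+\kappa\,\partial_L\varphi_n(q_n)$; 2. $-p_{i-1}+D_qF_{i-1}(q_{i-1},u_{i-1})^*p_i\in\lambda_0\,d_qL_{i-1}(q_{i-1},u_{i-1})+\kappa\,\partial_L\varphi_{i-1}(q_{i-1})$ for $2\le i\le n$; 3. $H_i(\lambda_0,u_i,p_{i+1})=\max_{u\in\mathcal{U}_i}H_i(\lambda_0,u,p_{i+1})$ for $0\le i\le n-1$, where $$H_i(\lambda,u,p)=\big\langle p,\ \mathbb{F}E_{f_i(q_i,u_i)}\big(f_i(q_i,u)\big)\big\rangle-\lambda L_i(q_i,u);$$ 4. $\lambda_0=1$ or $(p_1,\dots,p_n)\ne 0$. -/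

import Mathlib

open Set Filter Topology Bundle
open scoped Manifold ContDiff

noncomputable section

section NonsmoothAnalysis

variable {EQ : Type*} [NormedAddCommGroup EQ] [NormedSpace ℝ EQ]
  {Q : Type*} [TopologicalSpace Q] [ChartedSpace EQ Q]

/-- The cotangent space `T*_q Q` of a manifold modelled on `EQ`. -/
abbrev Covector (EQ : Type*) [NormedAddCommGroup EQ] [NormedSpace ℝ EQ]
    {Q : Type*} [TopologicalSpace Q] [ChartedSpace EQ Q] (q : Q) : Type _ :=
  TangentSpace 𝓘(ℝ, EQ) q →L[ℝ] ℝ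

/-- The differential `dh(q)` of a real function, as a covector. -/
def dCovector (EQ : Type*) [NormedAddCommGroup EQ] [NormedSpace ℝ EQ]
    {Q : Type*} [TopologicalSpace Q] [ChartedSpace EQ Q] (h : Q → ℝ) (q : Q) : Covector EQ q :=
  mfderiv 𝓘(ℝ, EQ) 𝓘(ℝ, ℝ) h q

/-- The pullback `DG(q)^* p` of a covector `p` at `G q` along `G : Q → Q`. -/
def pullbackCovector (G : Q → Q) (q : Q) (p : Covector EQ (G q)) : Covector EQ q :=
  p.comp (mfderiv 𝓘(ℝ, EQ) 𝓘(ℝ, EQ) G q)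

/-- Convergence `p k → p` in the total space of the cotangent bundle, where `p k` is a covector
at `x k` and `p` a covector at `q`. -/
def CovectorTendsto [IsManifold 𝓘(ℝ, EQ) ∞ Q] (x : ℕ → Q) (p : ∀ k, Covector EQ (x k))
    (q : Q) (p' : Covector EQ q) : Prop :=
  Tendsto
    (fun k => (⟨x k, p k⟩ : TotalSpace (EQ →L[ℝ] ℝ)
      (fun y : Q => TangentSpace 𝓘(ℝ, EQ) y →L[ℝ] Bundle.Trivial Q ℝ y)))
    atTop (𝓝 ⟨q, p'⟩)

/-- `f : Q → ℝ` is locally Lipschitz: around each point there is a coordinate chart in which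
`f` is Lipschitz. -/
def LocallyLipschitzOnManifold (EQ : Type*) [NormedAddCommGroup EQ] [NormedSpace ℝ EQ]
    {Q : Type*} [TopologicalSpace Q] [ChartedSpace EQ Q] (f : Q → ℝ) : Prop :=
  ∀ q : Q, ∃ c ∈ IsManifold.maximalAtlas 𝓘(ℝ, EQ) ∞ Q, q ∈ c.source ∧
    ∃ K : NNReal, LipschitzOnWith K (f ∘ c.symm) c.target

/-- The Fréchet subdifferential of `f` at `q`: the differentials `dg(q)` of `C¹` functions `g`
such that `f - g` has a local minimum at `q`. -/
def frechetSubdiff (f : Q → ℝ) (q : Q) : Set (Covector EQ q) :=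
  {p | ∃ g : Q → ℝ, ContMDiff 𝓘(ℝ, EQ) 𝓘(ℝ, ℝ) 1 g ∧
    dCovector EQ g q = p ∧ IsLocalMin (fun x => f x - g x) q}

/-- The limiting subdifferential of `f` at `q`. -/
def limitingSubdiff [IsManifold 𝓘(ℝ, EQ) ∞ Q] (f : Q → ℝ) (q : Q) : Set (Covector EQ q) :=
  {p' | ∃ (x : ℕ → Q) (p : ∀ k, Covector EQ (x k)),
    Tendsto x atTop (𝓝 q) ∧ (∀ k, p k ∈ frechetSubdiff f (x k)) ∧
    Tendsto (fun k => f (x k)) atTop (𝓝 (f q)) ∧ CovectorTendsto x p q p'}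

/-- The norm of a covector dual to the norm given by a Riemannian metric. -/
def covectorNorm [IsManifold 𝓘(ℝ, EQ) ∞ Q]
    (g : ContMDiffRiemannianMetric 𝓘(ℝ, EQ) ∞ EQ (fun q : Q => TangentSpace 𝓘(ℝ, EQ) q))
    (q : Q) (p : Covector EQ q) : ℝ :=
  sSup {r : ℝ | ∃ v : TangentSpace 𝓘(ℝ, EQ) q, g.inner q v v ≤ 1 ∧ r = p v}

/-- The set `{φ = 0}` is `φ`-regular at `x₀` (no dependence on a parameter).  Balls of the
Riemannian distance form a neighbourhood basis, so "for all `x` with `d(x, x₀) < ε`" is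
written as `∀ᶠ x in 𝓝 x₀`. -/
structure IsPhiRegularAt [IsManifold 𝓘(ℝ, EQ) ∞ Q]
    (g : ContMDiffRiemannianMetric 𝓘(ℝ, EQ) ∞ EQ (fun q : Q => TangentSpace 𝓘(ℝ, EQ) q))
    (φ : Q → ℝ) (x₀ : Q) : Prop where
  norm_ge : ∃ Δ > 0, ∀ᶠ x in 𝓝 x₀, 0 < φ x →
    ∀ p ∈ limitingSubdiff (EQ := EQ) φ x, Δ ≤ covectorNorm g x p
  subseq : ∀ (x : ℕ → Q) (p : ∀ k, Covector EQ (x k)), Tendsto x atTop (𝓝 x₀) →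
    (∀ k, p k ∈ limitingSubdiff φ (x k)) →
    ∃ (p' : Covector EQ x₀) (s : ℕ → ℕ), p' ∈ limitingSubdiff φ x₀ ∧ StrictMono s ∧
      CovectorTendsto (fun k => x (s k)) (fun k => p (s k)) x₀ p'

end NonsmoothAnalysis

section ControlSystem

variable {Q : Type*} {n : ℕ} {W : Fin n → Type*}

/-- The state sequence `q_0, …, q_n` with `q_{i+1} = F_i(q_i, u_i)`. -/
def stateSeq (F : ∀ i : Fin n, Q → W i → Q) (q₀ : Q) (u : ∀ i, W i) : Fin (n + 1) → Q :=
  Fin.induction q₀ (fun i q => F i q (u i))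

/-- The cost `J(u) = ℓ(q_n) + ∑_{i < n} L_i(q_i, u_i)`. -/
def totalCost (F : ∀ i : Fin n, Q → W i → Q) (q₀ : Q) (ℓ : Q → ℝ) (L : ∀ i : Fin n, Q → W i → ℝ)
    (u : ∀ i, W i) : ℝ :=
  ℓ (stateSeq F q₀ u (Fin.last n)) + ∑ i : Fin n, L i (stateSeq F q₀ u i.castSucc) (u i)

/-- Control sequences with values in the control sets `C i` whose states satisfy
`φ_j(q_j) = 0` for `j = 1, …, n` (`φ 0` is not used). -/
def admissible (F : ∀ i : Fin n, Q → W i → Q) (q₀ : Q) (C : ∀ i, Set (W i))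
    (φ : Fin (n + 1) → Q → ℝ) : Set (∀ i, W i) :=
  {u | (∀ i, u i ∈ C i) ∧ ∀ i : Fin n, φ i.succ (stateSeq F q₀ u i.succ) = 0}

end ControlSystem

section Hamiltonian

variable {EQ : Type*} [NormedAddCommGroup EQ] [NormedSpace ℝ EQ]
  {Q : Type*} [TopologicalSpace Q] [ChartedSpace EQ Q]
  {FX : Type*} {X : Q → Type*} [∀ q, AddCommGroup (X q)] [∀ q, Module ℝ (X q)]

/-- The fibre derivative `𝔽E_v(w) = d/dt|_{t=0} E(v + t w)` for `v, w` in the fibre `X q`. -/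
def fiberDeriv (E : TotalSpace FX X → Q) {q : Q} (v w : X q) :
    TangentSpace 𝓘(ℝ, EQ) (E ⟨q, v⟩) :=
  (mfderiv 𝓘(ℝ, ℝ) 𝓘(ℝ, EQ) (fun t : ℝ => E ⟨q, v + t • w⟩) 0 (1 : ℝ) : EQ)

/-- The Hamiltonian `H(lam, u, p) = ⟨𝔽E_{f(q, u₀)}^* p, f(q, u)⟩ - lam * L(q, u)`, with `p` a
covector at the point `E(f(q, u₀))`. -/
def hamiltonian {W : Type*} (E : TotalSpace FX X → Q) (f : ∀ q, W → X q) (L : Q → W → ℝ)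
    (q : Q) (u₀ : W) (lam : ℝ) (u : W) (p : Covector EQ (E ⟨q, f q u₀⟩)) : ℝ :=
  p (fiberDeriv E (f q u₀) (f q u)) - lam * L q u

end Hamiltonian

end

/-! Eliminating the states leaves a `C¹` cost on a convex set of control sequences, subject to `φ i
(q i) = 0`. On a compact piece around the optimum, adding the squared distance to it makes the
optimum strict, and the minimizers of cost plus `k ∑ φ i` converge to it as `k` grows
(`IsCompact.eventually_penalty_minimizer_mem`). If one of them with `k > 0` is feasible, it is the
optimum, the penalty is exact, and `λ₀ = 1`, `κ = k`. Otherwise all are infeasible, and division by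
`k` gives `κ = 1` and a cost weight tending to `λ₀ = 0`.

The penalized problems are nonsmooth. In `exists_fuzzy_multipliers` the states become free points
tied to the dynamics by a quadratic penalty: minimality in these points yields smooth subgradients,
minimality in the control an approximate first order condition. Part (b) of regularity gives limits
of the subgradients; part (a) keeps those at infeasible points away from zero, so the multipliers do
not all vanish when `λ₀ = 0` (`exists_multipliers_of_tendsto_minimizers`, `exists_multipliers`).

The costates solve the adjoint equation backwards in time. For a variation of a single control,
summation by parts (`adjoint_apply_variation`) turns the multiplier inequality into a bound for
`p_{i+1}` on the velocity of `q_{i+1}`. Since `f_i` is affine, that velocity is `𝔽E` applied to the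
difference of the values of `f_i`; since `L_i` is convex, its derivative is at most its increment.
This is the maximum condition. -/

/-! ### Convergence of penalty minimizers -/

/-- On a compact set, if `z₀` is the unique minimizer of `A` on the zero set of `P ≥ 0`, then the
minimizers of the penalized functions `A + m P` are close to `z₀` for large `m`. -/
theorem IsCompact.eventually_penalty_minimizer_mem {Z : Type*} [TopologicalSpace Z] {K : Set Z}
    (hK : IsCompact K) {A P : Z → ℝ} (hA : ContinuousOn A K) (hP : ContinuousOn P K)
    (hP0 : ∀ z ∈ K, 0 ≤ P z) {z₀ : Z} (hz₀ : z₀ ∈ K) (hPz₀ : P z₀ = 0)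
    (huniq : ∀ z ∈ K, P z = 0 → z ≠ z₀ → A z₀ < A z) {N : Set Z} (hN : N ∈ 𝓝 z₀) :
    ∀ᶠ m : ℝ in atTop, ∀ z ∈ K, IsMinOn (fun z => A z + m * P z) K z → z ∈ N := by
  obtain ⟨O, hON, hO, hzO⟩ := mem_nhds_iff.1 hN
  -- A bound that is eventually valid locally on `K` is eventually valid on all of `K`, by
  -- compactness.
  have key : ∀ᶠ m : ℝ in atTop, ∀ z ∈ K, z ∈ K → z ∉ O → A z₀ < A z + m * P z := by
    refine hK.induction_on (p := fun s => ∀ᶠ m : ℝ in atTop, ∀ z ∈ s, z ∈ K → z ∉ O →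
      A z₀ < A z + m * P z) ?_ ?_ ?_ ?_
    · simp
    · intro s t hst h
      filter_upwards [h] with m hm z hz using hm z (hst hz)
    · intro s t hs ht
      filter_upwards [hs, ht] with m h1 h2 z hz
      rcases hz with hz | hz
      · exact h1 z hz
      · exact h2 z hz
    · intro x hx
      by_cases hxO : x ∈ O
      · exact ⟨O, mem_nhdsWithin_of_mem_nhds (hO.mem_nhds hxO),
          .of_forall fun m z hz _ hz' => absurd hz hz'⟩
      · have hne : x ≠ z₀ := fun h => hxO (h ▸ hzO)
        obtain ⟨m₁, -, hm₁⟩ : ∃ m₁ : ℝ, 0 ≤ m₁ ∧ A z₀ < A x + m₁ * P x := by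
          rcases (hP0 x hx).eq_or_lt with h0 | h0
          · exact ⟨0, le_rfl, by simpa using huniq x hx h0.symm hne⟩
          -- This weight lifts the penalized value at `x` above `A z₀`, with a margin of at least
          -- `1`. As `P ≥ 0`, larger weights preserve the strict inequality.
          · refine ⟨(|A z₀ - A x| + 1) / P x, by positivity, ?_⟩
            rw [div_mul_cancel₀ _ h0.ne']
            linarith [le_abs_self (A z₀ - A x)]
        refine ⟨{z | A z₀ < A z + m₁ * P z}, ?_, ?_⟩
        · exact ((hA x hx).add ((hP x hx).const_mul m₁)).eventually_const_lt hm₁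
        · filter_upwards [eventually_ge_atTop m₁] with m hm z hz hzK _
          have h1 : A z₀ < A z + m₁ * P z := hz
          nlinarith [hP0 z hzK]
  filter_upwards [key] with m hm z hz hmin
  by_contra hzN
  have h1 := hm z hz hz (fun h => hzN (hON h))
  have h2 : A z + m * P z ≤ A z₀ + m * P z₀ := hmin hz₀
  rw [hPz₀] at h2
  linarith

/-! ### A smooth squared norm -/

section SquaredNorm

variable {V : Type*} [NormedAddCommGroup V] [NormedSpace ℝ V] [FiniteDimensional ℝ V]

/-- The square of a Euclidean norm on a finite-dimensional space. -/
noncomputable def euclSq (x : V) : ℝ := ‖toEuclidean x‖ ^ 2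

/-- The given norm of `V` need not be differentiable away from `0`; a Euclidean one gives penalties
that can be differentiated. -/
theorem contDiff_euclSq : ContDiff ℝ ∞ (euclSq : V → ℝ) :=
  (toEuclidean (E := V)).contDiff.norm_sq ℝ

theorem euclSq_nonneg (x : V) : 0 ≤ euclSq x := by unfold euclSq; positivity

theorem euclSq_eq_zero {x : V} : euclSq x = 0 ↔ x = 0 := by simp [euclSq]

@[simp] theorem euclSq_zero : euclSq (0 : V) = 0 := euclSq_eq_zero.2 rfl

theorem euclSq_pos {x : V} (hx : x ≠ 0) : 0 < euclSq x :=
  (euclSq_nonneg x).lt_of_ne fun h => hx (euclSq_eq_zero.1 h.symm)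

theorem differentiable_euclSq : Differentiable ℝ (euclSq : V → ℝ) :=
  contDiff_euclSq.differentiable (by simp)

theorem hasFDerivAt_euclSq_sub_const (x c : V) :
    HasFDerivAt (fun z => euclSq (z - c)) (fderiv ℝ euclSq (x - c)) x := by
  have h := (differentiable_euclSq (x - c)).hasFDerivAt.comp x ((hasFDerivAt_id x).sub_const c)
  rwa [ContinuousLinearMap.comp_id] at h

theorem continuous_euclSq : Continuous (euclSq : V → ℝ) := contDiff_euclSq.continuous

/-- Hence adding `euclSq (u - w)` isolates a minimizer `w` without changing the first order
condition there. -/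
theorem fderiv_euclSq_zero : fderiv ℝ (euclSq : V → ℝ) 0 = 0 :=
  IsLocalMin.fderiv_eq_zero (.of_forall fun x => by simpa using euclSq_nonneg x)

theorem continuous_fderiv_euclSq : Continuous (fderiv ℝ (euclSq : V → ℝ)) :=
  contDiff_euclSq.continuous_fderiv (by simp)

end SquaredNorm

/-! ### Approximate multipliers by decoupling -/

/-- A fuzzy multiplier rule: near a minimizer `w` of `h + κ ∑ ψ i ∘ y i` on a compact convex set
there are points where the first order condition holds approximately, with smooth subgradients of
the functions `ψ i`. -/
theorem exists_fuzzy_multipliers {W V ι : Type*} [Fintype ι]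
    [NormedAddCommGroup W] [NormedSpace ℝ W] [FiniteDimensional ℝ W]
    [NormedAddCommGroup V] [NormedSpace ℝ V] [FiniteDimensional ℝ V]
    {K : Set W} (hK : IsCompact K) (hKc : Convex ℝ K)
    {h : W → ℝ} {h' : W → W →L[ℝ] ℝ} (hh : ∀ u ∈ K, HasFDerivWithinAt h (h' u) K u)
    {y : ι → W → V} {y' : ι → W → W →L[ℝ] V}
    (hy : ∀ i, ∀ u ∈ K, HasFDerivWithinAt (y i) (y' i u) K u)
    {B : ι → Set V} (hB : ∀ i, IsCompact (B i)) {ψ : ι → V → ℝ}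
    (hψ : ∀ i, ContinuousOn (ψ i) (B i)) (hyB : ∀ i, ∀ u ∈ K, y i u ∈ interior (B i))
    {κ : ℝ} (hκ : 0 < κ) {w : W} (hw : w ∈ K)
    (hmin : IsMinOn (fun u => h u + κ * ∑ i, ψ i (y i u)) K w) {ε : ℝ} (hε : 0 < ε) :
    ∃ u ∈ K, dist u w < ε ∧ ∃ (x : ι → V) (a : ι → V →L[ℝ] ℝ),
      (∀ i, x i ∈ interior (B i)) ∧ (∀ i, dist (x i) (y i w) < ε) ∧
      (∀ i, ∃ g : V → ℝ, ContDiff ℝ ∞ g ∧ HasFDerivAt g (a i) (x i) ∧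
        IsLocalMin (fun z => ψ i z - g z) (x i)) ∧
      ∀ v ∈ K, -(ε * ‖v - u‖) ≤ h' u (v - u) + κ * ∑ i, a i (y' i u (v - u)) := by
  classical
  set Z : Set (W × (ι → V)) := K ×ˢ univ.pi B with hZ
  have hZc : IsCompact Z := hK.prod (isCompact_univ_pi hB)
  have hhc : ContinuousOn h K := fun u hu => (hh u hu).continuousWithinAt
  have hyc : ∀ i, ContinuousOn (y i) K := fun i u hu => (hy i u hu).continuousWithinAt
  have hfstZ : MapsTo Prod.fst Z K := fun z hz => hz.1
  have hsndZ : ∀ i, MapsTo (fun z : W × (ι → V) => z.2 i) Z (B i) := fun i z hz => hz.2 i trivial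
  have hsc : ∀ i, Continuous fun z : W × (ι → V) => z.2 i := fun i => by fun_prop
  -- The points `z.2 i` stand for `y i z.1` and are free; `P` measures the mismatch. The square in
  -- `A` makes `w` with its own images the unique minimizer on `P = 0`.
  set A : W × (ι → V) → ℝ := fun z => h z.1 + euclSq (z.1 - w) + κ * ∑ i, ψ i (z.2 i) with hA
  set P : W × (ι → V) → ℝ := fun z => ∑ i, euclSq (z.2 i - y i z.1) with hP
  have hAc : ContinuousOn A Z := by
    refine ((hhc.comp continuousOn_fst hfstZ).add ?_).add (continuousOn_const.mul ?_)
    · exact (continuous_euclSq.comp (continuous_fst.sub continuous_const)).continuousOn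
    · exact continuousOn_finsetSum _ fun i _ => (hψ i).comp (hsc i).continuousOn (hsndZ i)
  have hPc : ContinuousOn P Z := continuousOn_finsetSum _ fun i _ =>
    continuous_euclSq.comp_continuousOn
      ((hsc i).continuousOn.sub ((hyc i).comp continuousOn_fst hfstZ))
  have hz₀ : (w, fun i => y i w) ∈ Z := ⟨hw, fun i _ => interior_subset (hyB i w hw)⟩
  have hP0 : ∀ z, 0 ≤ P z := fun z => Finset.sum_nonneg fun i _ => euclSq_nonneg _
  have huniq : ∀ z ∈ Z, P z = 0 → z ≠ (w, fun i => y i w) → A (w, fun i => y i w) < A z := by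
    rintro ⟨u, x⟩ hz hPz hne
    have hx : x = fun i => y i u := by
      funext i
      have := (Finset.sum_eq_zero_iff_of_nonneg (fun i _ => euclSq_nonneg _)).1 hPz i
        (Finset.mem_univ i)
      exact sub_eq_zero.1 (euclSq_eq_zero.1 this)
    subst hx
    have huw : u ≠ w := by rintro rfl; exact hne rfl
    have h1 : h w + κ * ∑ i, ψ i (y i w) ≤ h u + κ * ∑ i, ψ i (y i u) := hmin hz.1
    have h2 := euclSq_pos (sub_ne_zero.2 huw)
    simp only [hA, sub_self, euclSq_zero]
    linarith
  have hN : {z : W × (ι → V) | dist z.1 w < ε ∧ ‖fderiv ℝ (euclSq : W → ℝ) (z.1 - w)‖ < ε ∧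
      ∀ i, z.2 i ∈ interior (B i) ∧ dist (z.2 i) (y i w) < ε} ∈ 𝓝 (w, fun i => y i w) := by
    refine IsOpen.mem_nhds ?_ ?_
    · simp only [ofPred_and, ofPred_forall]
      refine (isOpen_lt (by fun_prop) continuous_const).inter
        ((isOpen_lt ?_ continuous_const).inter (isOpen_iInter_of_finite fun i => ?_))
      · exact (continuous_fderiv_euclSq.comp (continuous_fst.sub continuous_const)).norm
      · exact (isOpen_interior.preimage (hsc i)).inter
          (isOpen_lt ((hsc i).dist continuous_const) continuous_const)
    · simp [fderiv_euclSq_zero, hε, fun i => hyB i w hw]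
  obtain ⟨m, hm⟩ := ((hZc.eventually_penalty_minimizer_mem hAc hPc (fun z _ => hP0 z) hz₀
    (by simp [hP]) huniq hN).and (eventually_gt_atTop 0)).exists
  obtain ⟨⟨u, x⟩, hz, hzmin⟩ := hZc.exists_isMinOn ⟨_, hz₀⟩
    (hAc.add (continuousOn_const.mul hPc) : ContinuousOn (fun z => A z + m * P z) Z)
  replace hzmin : ∀ z ∈ Z, A (u, x) + m * P (u, x) ≤ A z + m * P z := fun z hz => hzmin hz
  obtain ⟨h1, h2, h3⟩ := hm.1 _ hz hzmin
  have hu : u ∈ K := hz.1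
  -- Minimality in `x i` alone says that `ψ i + (m / κ) * euclSq (· - y i u)` has a local minimum at
  -- `x i`, so minus the quadratic term is a smooth function whose derivative there is a
  -- subgradient.
  set a : ι → V →L[ℝ] ℝ := fun i => (-(m / κ)) • fderiv ℝ euclSq (x i - y i u) with ha
  refine ⟨u, hu, h1, x, a, fun i => (h3 i).1, fun i => (h3 i).2, fun i => ?_, fun v hv => ?_⟩
  · refine ⟨fun z => (-(m / κ)) • euclSq (z - y i u), ?_, ?_, ?_⟩
    · exact (contDiff_euclSq.comp (contDiff_id.sub contDiff_const)).const_smul _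
    · exact (hasFDerivAt_euclSq_sub_const (x i) (y i u)).const_smul (-(m / κ))
    · have hBi : interior (B i) ∈ 𝓝 (x i) := isOpen_interior.mem_nhds (h3 i).1
      filter_upwards [hBi] with z hzB
      have hmem : (u, Function.update x i z) ∈ Z := by
        refine ⟨hu, fun j _ => ?_⟩
        rcases eq_or_ne j i with rfl | hji
        · simpa using interior_subset hzB
        · simpa [hji] using hz.2 j trivial
      have := hzmin _ hmem
      simp only [hA, hP, Fintype.sum_eq_add_sum_compl i, Function.update_self] at this
      have e1 : ∀ G : ι → V → ℝ, ∑ j ∈ {i}ᶜ, G j (Function.update x i z j)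
          = ∑ j ∈ {i}ᶜ, G j (x j) := fun G => Finset.sum_congr rfl fun j hj => by
        rw [Function.update_of_ne (by simpa using hj)]
      rw [e1 ψ, e1 (fun j p => euclSq (p - y j u))] at this
      have h4 : ψ i (x i) + m / κ * euclSq (x i - y i u) ≤
          ψ i z + m / κ * euclSq (z - y i u) := by
        have : κ * (ψ i (x i) + m / κ * euclSq (x i - y i u)) ≤
            κ * (ψ i z + m / κ * euclSq (z - y i u)) := by
          have hc : κ * (m / κ) = m := mul_div_cancel₀ m hκ.ne'
          simp only [mul_add, ← mul_assoc, hc] at this ⊢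
          linarith
        exact le_of_mul_le_mul_left this hκ
      simp only [smul_eq_mul]
      linarith
  -- With `x` frozen only the smooth terms vary with `u`. The derivative of the mismatch penalty is
  -- exactly `κ ∑ a i ∘ y' i`, the signs from `a` and from `x i - y i u` matching.
  · have hd : HasFDerivWithinAt
        (fun u => h u + euclSq (u - w) + m * ∑ i, euclSq (x i - y i u))
        (h' u + fderiv ℝ euclSq (u - w)
          + m • ∑ i, (fderiv ℝ euclSq (x i - y i u)).comp (-(y' i u))) K u := by
      refine ((hh u hu).add ?_).add ((HasFDerivWithinAt.fun_sum fun i _ => ?_).const_mul m)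
      · exact (hasFDerivAt_euclSq_sub_const u w).hasFDerivWithinAt
      · exact (differentiable_euclSq (x i - y i u)).hasFDerivAt.comp_hasFDerivWithinAt u
          ((hy i u hu).const_sub (x i))
    have hminu : IsMinOn (fun u => h u + euclSq (u - w) + m * ∑ i, euclSq (x i - y i u)) K u := by
      intro v hv
      have := hzmin (v, x) ⟨hv, hz.2⟩
      simp only [mem_ofPred_eq, hA, hP] at this ⊢
      linarith
    have h4 := hminu.localize.hasFDerivWithinAt_nonneg hd
      (sub_mem_posTangentConeAt_of_segment_subset (hKc.segment_subset hu hv))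
    have h5 : |fderiv ℝ euclSq (u - w) (v - u)| ≤ ε * ‖v - u‖ :=
      (ContinuousLinearMap.le_opNorm _ _).trans
        (mul_le_mul_of_nonneg_right h2.le (norm_nonneg _))
    have h6 : κ * ∑ i, a i (y' i u (v - u)) =
        m * ∑ i, (fderiv ℝ euclSq (x i - y i u)) (-(y' i u (v - u))) := by
      rw [Finset.mul_sum, Finset.mul_sum]
      refine Finset.sum_congr rfl fun i _ => ?_
      simp only [ha, _root_.smul_apply, smul_eq_mul, map_neg]
      field_simp
    rw [h6]
    simp only [_root_.add_apply, _root_.smul_apply,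
      _root_.sum_apply, ContinuousLinearMap.comp_apply, _root_.neg_apply,
      smul_eq_mul] at h4
    linarith [abs_le.1 h5]

/-! ### Derivatives within convex sets -/

/-- A property that holds near `x` in `s` holds on the small closed balls around `x`. -/
theorem eventually_forall_mem_inter_closedBall {W : Type*} [PseudoMetricSpace W] {s : Set W}
    {x : W} {p : W → Prop} (h : ∀ᶠ z in 𝓝[s] x, p z) :
    ∀ᶠ r in 𝓝[>] (0 : ℝ), ∀ z ∈ s ∩ Metric.closedBall x r, p z := by
  obtain ⟨r, hr, hrp⟩ := (nhdsWithin_hasBasis Metric.nhds_basis_closedBall s).mem_iff.1 h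
  filter_upwards [Ioo_mem_nhdsGT hr] with r' hr' z hz
  exact hrp ⟨Metric.closedBall_subset_closedBall hr'.2.le hz.2, hz.1⟩

/-- A function that is `C¹` on `s` has, near each point of `s`, derivatives within `s` that depend
continuously on the point. -/
theorem ContDiffWithinAt.exists_hasFDerivWithinAt_ball {W V : Type*}
    [NormedAddCommGroup W] [NormedSpace ℝ W] [NormedAddCommGroup V] [NormedSpace ℝ V]
    {s : Set W} {f : W → V} {x : W} (hx : x ∈ s) (hf : ContDiffWithinAt ℝ 1 f s x) :
    ∃ f' : W → W →L[ℝ] V, ContinuousWithinAt f' s x ∧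
      ∀ᶠ r in 𝓝[>] (0 : ℝ), ∀ z ∈ s ∩ Metric.closedBall x r,
        HasFDerivWithinAt f (f' z) (s ∩ Metric.closedBall x r) z := by
  have hf1 : ContDiffWithinAt ℝ (0 + 1) f s x := by simpa using hf
  -- Derivatives within `s` need not be unique, so one family that varies continuously is fixed.
  obtain ⟨t, ht, -, f', hf', hc⟩ :=
    (contDiffWithinAt_succ_iff_hasFDerivWithinAt (by simp)).1 hf1
  rw [insert_eq_of_mem hx] at ht
  refine ⟨f', hc.continuousWithinAt.mono_of_mem_nhdsWithin ht, ?_⟩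
  filter_upwards [eventually_forall_mem_inter_closedBall ht] with r hr z hz
  exact (hf' z (hr z hz)).mono hr

/-- The derivative within `K` along a segment of `K` is the one-sided derivative. -/
theorem HasFDerivWithinAt.apply_eq_of_hasDerivWithinAt_line {W V : Type*}
    [NormedAddCommGroup W] [NormedSpace ℝ W] [NormedAddCommGroup V] [NormedSpace ℝ V]
    {K : Set W} {f : W → V} {f' : W →L[ℝ] V} {x w : W} (hf : HasFDerivWithinAt f f' K x)
    {t₀ : ℝ} (ht₀ : 0 < t₀) (ht₁ : t₀ ≤ 1) (hK : ∀ t ∈ Icc 0 t₀, x + t • w ∈ K) {δ : V}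
    (hδ : HasDerivWithinAt (fun t : ℝ => f (x + t • w)) δ (Icc 0 1) 0) : f' w = δ := by
  have h1 : HasDerivWithinAt (fun t : ℝ => x + t • w) w (Icc 0 t₀) 0 := by
    have h := ((hasDerivAt_id (0 : ℝ)).smul_const w).const_add x
    rw [one_smul] at h
    exact h.hasDerivWithinAt
  have h2 : HasFDerivWithinAt f f' K (x + (0 : ℝ) • w) := by simpa using hf
  -- Uniqueness on an interval determines `f'` on feasible directions, even where `f'` itself is not
  -- unique.
  exact (uniqueDiffOn_Icc ht₀ 0 ⟨le_rfl, ht₀.le⟩).eq_deriv _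
    (h2.comp_hasDerivWithinAt 0 h1 hK) (hδ.mono (Icc_subset_Icc_right ht₁))

/-! ### Covectors in charts -/

section CotangentCoordinates

variable {EQ : Type*} [NormedAddCommGroup EQ] [NormedSpace ℝ EQ]
  {Q : Type*} [TopologicalSpace Q] [ChartedSpace EQ Q]

/-- The covector at `x` with coordinates `a` in the preferred chart at `x₀`. -/
noncomputable def covectorOfCoord (x₀ x : Q) (a : EQ →L[ℝ] ℝ) : Covector EQ x :=
  a.comp (mfderiv 𝓘(ℝ, EQ) 𝓘(ℝ, EQ) (extChartAt 𝓘(ℝ, EQ) x₀) x)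

variable [IsManifold 𝓘(ℝ, EQ) ∞ Q]

/-- A smooth subgradient in a chart gives a Fréchet subgradient on the manifold. -/
theorem covectorOfCoord_mem_frechetSubdiff [FiniteDimensional ℝ EQ] [T2Space Q]
    {f : Q → ℝ} {x₀ x : Q} (hx : x ∈ (chartAt EQ x₀).source) {a : EQ →L[ℝ] ℝ} {g : EQ → ℝ}
    (hg : ContDiff ℝ ∞ g) (hga : HasFDerivAt g a (extChartAt 𝓘(ℝ, EQ) x₀ x))
    (hmin : IsLocalMin (fun z => f ((extChartAt 𝓘(ℝ, EQ) x₀).symm z) - g z)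
      (extChartAt 𝓘(ℝ, EQ) x₀ x)) :
    covectorOfCoord x₀ x a ∈ frechetSubdiff f x := by
  set c := extChartAt 𝓘(ℝ, EQ) x₀ with hc
  have hxc : x ∈ c.source := by simpa [hc] using hx
  have hxs : c.source ∈ 𝓝 x := extChartAt_source_mem_nhds' hxc
  -- Fréchet subgradients require functions defined on all of `Q`: a bump function supported in the
  -- chart extends `g ∘ c` smoothly without changing it near `x`.
  obtain ⟨b, hb, -⟩ := (SmoothBumpFunction.nhds_basis_support (I := 𝓘(ℝ, EQ)) (c := x) hxs
    ).mem_iff.1 hxs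
  have hG : ContMDiff 𝓘(ℝ, EQ) 𝓘(ℝ, ℝ) ∞ fun z => b z • g (c z) := by
    refine contMDiff_of_tsupport fun z hz => ?_
    have hz' : z ∈ (chartAt EQ x₀).source := by
      simpa [hc] using hb (tsupport_smul_subset_left b _ hz)
    exact b.contMDiffAt.smul (hg.contMDiff.contMDiffAt.comp z (contMDiffAt_extChartAt' hz'))
  have hev : (fun z => b z • g (c z)) =ᶠ[𝓝 x] fun z => g (c z) := by
    filter_upwards [b.eventuallyEq_one] with z hz
    simp [hz]
  refine ⟨fun z => b z • g (c z), hG.of_le (by simp), ?_, ?_⟩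
  · have h1 : HasMFDerivAt 𝓘(ℝ, EQ) 𝓘(ℝ, ℝ) g (c x) a := hga.hasMFDerivAt
    have h2 := (mdifferentiableAt_extChartAt (I := 𝓘(ℝ, EQ)) hx).hasMFDerivAt
    exact ((h1.comp x h2).congr_of_eventuallyEq hev).mfderiv
  · have h3 := (continuousAt_extChartAt' hxc).eventually hmin
    filter_upwards [h3, hev, hxs] with z hz hzb hzs
    have e1 : b x • g (c x) = g (c x) := hev.self_of_nhds
    rw [c.left_inv hxc, c.left_inv hzs] at hz
    rw [hzb, e1]
    exact hz

theorem frechetSubdiff_subset_limitingSubdiff (f : Q → ℝ) (x : Q) :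
    frechetSubdiff (EQ := EQ) f x ⊆ limitingSubdiff f x := fun p hp =>
  ⟨fun _ => x, fun _ => p, tendsto_const_nhds, fun _ => hp, tendsto_const_nhds,
    tendsto_const_nhds⟩

/-- The trivialization of the tangent bundle at `q` is the derivative of the chart, so passing to
coordinates cancels the composition in `covectorOfCoord`. -/
theorem inCoordinates_covectorOfCoord {q x : Q} (hx : x ∈ (chartAt EQ q).source)
    (a : EQ →L[ℝ] ℝ) :
    ContinuousLinearMap.inCoordinates EQ (fun y : Q => TangentSpace 𝓘(ℝ, EQ) y) ℝ
      (Bundle.Trivial Q ℝ) q x q x (covectorOfCoord q x a) = a := by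
  ext v
  have hb : x ∈ (trivializationAt EQ (fun y : Q => TangentSpace 𝓘(ℝ, EQ) y) q).baseSet := by
    simpa using hx
  have h := (trivializationAt EQ (fun y : Q => TangentSpace 𝓘(ℝ, EQ) y) q).continuousLinearMapAt_symmL
    (R := ℝ) hb v
  rw [TangentBundle.continuousLinearMapAt_trivializationAt hx] at h
  have h' := congrArg a h
  have ht : (trivializationAt ℝ (Bundle.Trivial Q ℝ) q).continuousLinearMapAt ℝ x =
      ContinuousLinearMap.id ℝ ℝ := by
    ext
    simp
  rw [ContinuousLinearMap.inCoordinates, ht]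
  exact h'

theorem covectorOfCoord_self (q : Q) (a : EQ →L[ℝ] ℝ) : covectorOfCoord q q a = a := by
  rw [covectorOfCoord, mfderiv_extChartAt_self]
  exact ContinuousLinearMap.comp_id a

theorem trivializationAt_covectorOfCoord {q x : Q} (hx : x ∈ (chartAt EQ q).source)
    (a : EQ →L[ℝ] ℝ) :
    trivializationAt (EQ →L[ℝ] ℝ)
      (fun y : Q => TangentSpace 𝓘(ℝ, EQ) y →L[ℝ] Bundle.Trivial Q ℝ y) q
      ⟨x, covectorOfCoord q x a⟩ = (x, a) :=
  (hom_trivializationAt_apply (RingHom.id ℝ) q _).trans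
    (congrArg (Prod.mk x) (inCoordinates_covectorOfCoord hx a))

/-- Convergence in the cotangent bundle implies convergence of the coordinates. -/
theorem CovectorTendsto.tendsto_coord {x : ℕ → Q} {a : ℕ → EQ →L[ℝ] ℝ} {q : Q}
    {b : EQ →L[ℝ] ℝ}
    (h : CovectorTendsto x (fun k => covectorOfCoord q (x k) (a k)) q (covectorOfCoord q q b)) :
    Tendsto a atTop (𝓝 b) := by
  have h1 : Tendsto x atTop (𝓝 q) :=
    ((FiberBundle.continuous_proj (EQ →L[ℝ] ℝ)
      (fun y : Q => TangentSpace 𝓘(ℝ, EQ) y →L[ℝ] Bundle.Trivial Q ℝ y)).tendsto _).comp h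
  have hq := mem_chart_source EQ q
  have h2 : Tendsto (fun k => trivializationAt (EQ →L[ℝ] ℝ)
      (fun y : Q => TangentSpace 𝓘(ℝ, EQ) y →L[ℝ] Bundle.Trivial Q ℝ y) q
      ⟨x k, covectorOfCoord q (x k) (a k)⟩) atTop
      (𝓝 (trivializationAt (EQ →L[ℝ] ℝ)
      (fun y : Q => TangentSpace 𝓘(ℝ, EQ) y →L[ℝ] Bundle.Trivial Q ℝ y) q
      ⟨q, covectorOfCoord q q b⟩)) :=
    ((trivializationAt (EQ →L[ℝ] ℝ)
      (fun y : Q => TangentSpace 𝓘(ℝ, EQ) y →L[ℝ] Bundle.Trivial Q ℝ y) q).continuousAt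
      ((Trivialization.mem_source _).2 (FiberBundle.mem_baseSet_trivializationAt' q))).tendsto.comp
      h
  rw [trivializationAt_covectorOfCoord hq] at h2
  refine ((continuous_snd.tendsto _).comp h2).congr' ?_
  filter_upwards [h1 ((chartAt EQ q).open_source.mem_nhds hq)] with k hk
  exact congrArg Prod.snd (trivializationAt_covectorOfCoord hk (a k))

/-- A continuous metric keeps the derivative of the chart bounded near `q`. Thus coordinates tending
to zero contradict the lower bound `Δ` of regularity. -/
theorem exists_covectorNorm_covectorOfCoord_le
    (g : ContMDiffRiemannianMetric 𝓘(ℝ, EQ) ∞ EQ (fun q : Q => TangentSpace 𝓘(ℝ, EQ) q))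
    (q : Q) : ∃ M : ℝ, ∀ᶠ x in 𝓝 q, ∀ a : EQ →L[ℝ] ℝ,
      covectorNorm g x (covectorOfCoord q x a) ≤ M * ‖a‖ := by
  let : RiemannianBundle (fun q : Q => TangentSpace 𝓘(ℝ, EQ) q) :=
    ⟨g.toContinuousRiemannianMetric.toRiemannianMetric⟩
  have : IsContinuousRiemannianBundle EQ (fun q : Q => TangentSpace 𝓘(ℝ, EQ) q) :=
    ⟨⟨g.inner, g.contMDiff.continuous, fun _ _ _ => rfl⟩⟩
  obtain ⟨M, hM, h⟩ := eventually_norm_mfderiv_extChartAt_lt 𝓘(ℝ, EQ) q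
  refine ⟨M, ?_⟩
  filter_upwards [h] with x hx a
  refine csSup_le ⟨0, 0, by simp, by simp⟩ ?_
  rintro r ⟨v, hv, rfl⟩
  have hv1 : ‖v‖ ≤ 1 := by
    have h1 : ‖v‖ ^ 2 ≤ 1 := by
      rw [← real_inner_self_eq_norm_sq]
      exact hv
    nlinarith [norm_nonneg v]
  let D : TangentSpace 𝓘(ℝ, EQ) x →L[ℝ] EQ :=
    mfderiv 𝓘(ℝ, EQ) 𝓘(ℝ, EQ) (extChartAt 𝓘(ℝ, EQ) q) x
  have hD : ‖D‖ < M := hx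
  have h2 : ‖D v‖ ≤ ‖D‖ * ‖v‖ := D.le_opNorm v
  calc covectorOfCoord q x a v ≤ ‖a‖ * ‖D v‖ := (le_abs_self _).trans (a.le_opNorm (D v))
    _ ≤ ‖a‖ * M := by
        gcongr
        refine h2.trans ?_
        nlinarith [norm_nonneg v]
    _ = M * ‖a‖ := mul_comm _ _

end CotangentCoordinates

/-! ### One-sided velocities of curves -/

section CurveDerivatives

variable {EQ : Type*} [NormedAddCommGroup EQ] [NormedSpace ℝ EQ]
  {Q : Type*} [TopologicalSpace Q] [ChartedSpace EQ Q]

/-- The curve `c : [0, 1] → Q` starts at `q` with one-sided velocity `ξ`. -/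
structure HasInitialVelocity (c : ℝ → Q) (q : Q) (ξ : EQ) : Prop where
  start : c 0 = q
  continuousWithinAt : ContinuousWithinAt c (Icc 0 1) 0
  hasDerivWithinAt : HasDerivWithinAt (fun t => extChartAt 𝓘(ℝ, EQ) q (c t)) ξ (Icc 0 1) 0

theorem hasInitialVelocity_const (q : Q) :
    HasInitialVelocity (fun _ => q) q (0 : EQ) :=
  ⟨rfl, continuousWithinAt_const, hasDerivWithinAt_const ..⟩

theorem HasInitialVelocity.congr {c c' : ℝ → Q} {q : Q} {ξ : EQ}
    (h : HasInitialVelocity c q ξ) (hc : EqOn c' c (Icc 0 1)) : HasInitialVelocity c' q ξ := by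
  have h0 : (0 : ℝ) ∈ Icc (0 : ℝ) 1 := by simp
  refine ⟨(hc h0).trans h.start, h.continuousWithinAt.congr hc (hc h0),
    h.hasDerivWithinAt.congr (fun t ht => ?_) ?_⟩
  · simp [hc ht]
  · simp [hc h0]

theorem MDifferentiableAt.hasInitialVelocity {c : ℝ → Q}
    (hc : MDifferentiableAt 𝓘(ℝ, ℝ) 𝓘(ℝ, EQ) c 0) :
    HasInitialVelocity (EQ := EQ) c (c 0) (mfderiv 𝓘(ℝ, ℝ) 𝓘(ℝ, EQ) c 0 (1 : ℝ)) := by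
  have h := hc.hasMFDerivAt
  let D : ℝ →L[ℝ] EQ := mfderiv 𝓘(ℝ, ℝ) 𝓘(ℝ, EQ) c 0
  have h2 : HasFDerivWithinAt (fun t => extChartAt 𝓘(ℝ, EQ) (c 0) (c t)) D univ 0 := by
    simpa [D, writtenInExtChartAt, Function.comp_def] using! h.2
  exact ⟨rfl, h.1.continuousWithinAt, (h2.mono (subset_univ _)).hasDerivWithinAt⟩

theorem HasInitialVelocity.hasDerivWithinAt_extChartAt_comp {E' M' : Type*}
    [NormedAddCommGroup E'] [NormedSpace ℝ E'] [TopologicalSpace M'] [ChartedSpace E' M']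
    {c : ℝ → Q} {q : Q} {ξ : EQ} (h : HasInitialVelocity c q ξ)
    {G : Q → M'} {D : TangentSpace 𝓘(ℝ, EQ) q →L[ℝ] TangentSpace 𝓘(ℝ, E') (G q)}
    (hG : HasMFDerivAt 𝓘(ℝ, EQ) 𝓘(ℝ, E') G q D) :
    HasDerivWithinAt (fun t => extChartAt 𝓘(ℝ, E') (G q) (G (c t))) (D ξ : E') (Icc 0 1) 0 := by
  have h2 : HasFDerivAt (writtenInExtChartAt 𝓘(ℝ, EQ) 𝓘(ℝ, E') q G) (D : EQ →L[ℝ] E')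
      (extChartAt 𝓘(ℝ, EQ) q (c 0)) := by
    have h1 := hG.2
    rw [ModelWithCorners.range_eq_univ] at h1
    rw [h.start]
    exact hasFDerivWithinAt_univ.1 h1
  refine (h2.comp_hasDerivWithinAt 0 h.hasDerivWithinAt).congr_of_eventuallyEq ?_ ?_
  · have hs : ∀ᶠ x in 𝓝 (c 0), x ∈ (extChartAt 𝓘(ℝ, EQ) q).source := by
      rw [h.start]
      exact extChartAt_source_mem_nhds q
    filter_upwards [h.continuousWithinAt hs] with t ht
    simp only [Function.comp_apply, writtenInExtChartAt]
    rw [(extChartAt 𝓘(ℝ, EQ) q).left_inv ht]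
  · simp [writtenInExtChartAt, h.start]

theorem HasInitialVelocity.comp {c : ℝ → Q} {q : Q} {ξ : EQ}
    (h : HasInitialVelocity c q ξ) {G : Q → Q}
    (hG : MDifferentiableAt 𝓘(ℝ, EQ) 𝓘(ℝ, EQ) G q) :
    HasInitialVelocity (EQ := EQ) (fun t => G (c t)) (G q) (mfderiv 𝓘(ℝ, EQ) 𝓘(ℝ, EQ) G q ξ) := by
  have hcG : ContinuousAt G (c 0) := by rw [h.start]; exact hG.continuousAt
  exact ⟨congrArg G h.start, hcG.comp_continuousWithinAt h.continuousWithinAt,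
    h.hasDerivWithinAt_extChartAt_comp (E' := EQ) hG.hasMFDerivAt⟩

theorem HasInitialVelocity.hasDerivWithinAt_comp {c : ℝ → Q} {q : Q}
    {ξ : EQ} (h : HasInitialVelocity c q ξ) {G : Q → ℝ}
    (hG : MDifferentiableAt 𝓘(ℝ, EQ) 𝓘(ℝ, ℝ) G q) :
    HasDerivWithinAt (fun t => G (c t)) (dCovector EQ G q ξ) (Icc 0 1) 0 :=
  h.hasDerivWithinAt_extChartAt_comp hG.hasMFDerivAt

end CurveDerivatives

/-! ### Linearity of the fibre derivative -/

section FiberDerivative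

variable {EQ : Type*} [NormedAddCommGroup EQ] [NormedSpace ℝ EQ]
  {Q : Type*} [TopologicalSpace Q] [ChartedSpace EQ Q]
  {FX : Type*} [NormedAddCommGroup FX] [NormedSpace ℝ FX]
  {X : Q → Type*} [∀ q, AddCommGroup (X q)] [∀ q, Module ℝ (X q)] [∀ q, TopologicalSpace (X q)]
  [TopologicalSpace (TotalSpace FX X)] [FiberBundle FX X] [VectorBundle ℝ FX X]
  [ContMDiffVectorBundle ∞ FX X 𝓘(ℝ, EQ)]

/-- The fibre derivative of a `C¹` map on a vector bundle is linear in the direction. -/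
theorem exists_fiberDeriv_eq {E : TotalSpace FX X → Q}
    (hE : ContMDiff (𝓘(ℝ, EQ).prod 𝓘(ℝ, FX)) 𝓘(ℝ, EQ) 1 E) {q : Q} (v : X q) :
    ∃ D : X q →ₗ[ℝ] TangentSpace 𝓘(ℝ, EQ) (E ⟨q, v⟩), ∀ w : X q,
      fiberDeriv E v w = D w ∧
      MDifferentiableAt 𝓘(ℝ, ℝ) 𝓘(ℝ, EQ) (fun t : ℝ => E ⟨q, v + t • w⟩) 0 := by
  set e := trivializationAt FX X q
  have hq : q ∈ e.baseSet := FiberBundle.mem_baseSet_trivializationAt' q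
  let A := e.continuousLinearEquivAt ℝ q hq
  -- A trivialization, linear on the fibre, reads `E` on `X q` as a `C¹` map on the normed space
  -- `FX`; `fiberDeriv` is then a directional derivative of that map.
  have hΨ : ContMDiff 𝓘(ℝ, FX) 𝓘(ℝ, EQ) 1 fun z : FX => E ⟨q, A.symm z⟩ := by
    refine hE.comp ?_
    have h1 : ContMDiffOn (𝓘(ℝ, EQ).prod 𝓘(ℝ, FX)) (𝓘(ℝ, EQ).prod 𝓘(ℝ, FX)) 1
        e.toOpenPartialHomeomorph.symm e.target := (e.contMDiffOn_symm (n := ∞)).of_le (by simp)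
    have h2 : ContMDiff 𝓘(ℝ, FX) (𝓘(ℝ, EQ).prod 𝓘(ℝ, FX)) 1 fun z : FX => (q, z) :=
      contMDiff_const.prodMk contMDiff_id
    refine (h1.comp_contMDiff h2 fun z => e.mem_target.2 hq).congr fun z => ?_
    have h3 : A.symm z = e.symm q z :=
      (congrFun (e.symm_continuousLinearEquivAt_eq (R := ℝ) hq) z).trans (e.symmL_apply hq z)
    rw [h3]
    exact e.mk_symm hq z
  have hΨd : MDifferentiableAt 𝓘(ℝ, FX) 𝓘(ℝ, EQ) (fun z : FX => E ⟨q, A.symm z⟩) (A v) :=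
    hΨ.mdifferentiable (by simp) _
  let D : FX →L[ℝ] EQ := mfderiv 𝓘(ℝ, FX) 𝓘(ℝ, EQ) (fun z : FX => E ⟨q, A.symm z⟩) (A v)
  refine ⟨D.toLinearMap ∘ₗ A.toLinearMap, fun w => ?_⟩
  have hline : HasMFDerivAt 𝓘(ℝ, ℝ) 𝓘(ℝ, FX) (fun t : ℝ => A v + t • A w) 0
      (ContinuousLinearMap.toSpanSingleton ℝ (A w)) := by
    refine HasFDerivAt.hasMFDerivAt ?_
    have h1 := ((hasDerivAt_id (0 : ℝ)).smul_const (A w)).const_add (A v)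
    rw [one_smul] at h1
    exact h1.hasFDerivAt
  have hΨ' : HasMFDerivAt 𝓘(ℝ, FX) 𝓘(ℝ, EQ) (fun z : FX => E ⟨q, A.symm z⟩)
      (A v + (0 : ℝ) • A w) D := by
    rw [zero_smul, add_zero]
    exact hΨd.hasMFDerivAt
  have hcomp := hΨ'.comp (0 : ℝ) hline
  have hfun : (fun z : FX => E ⟨q, A.symm z⟩) ∘ (fun t : ℝ => A v + t • A w) =
      fun t : ℝ => E ⟨q, v + t • w⟩ := by
    funext t
    simp
  rw [hfun] at hcomp
  refine ⟨?_, hcomp.mdifferentiableAt⟩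
  have := congrArg (fun T : ℝ →L[ℝ] EQ => T 1) hcomp.mfderiv
  refine Eq.trans this ?_
  show D ((1 : ℝ) • A w) = D (A w)
  rw [one_smul]

end FiberDerivative

theorem LocallyLipschitzOnManifold.continuous {EQ : Type*} [NormedAddCommGroup EQ]
    [NormedSpace ℝ EQ] {Q : Type*} [TopologicalSpace Q] [ChartedSpace EQ Q] {f : Q → ℝ}
    (hf : LocallyLipschitzOnManifold EQ f) : Continuous f := by
  refine continuous_iff_continuousAt.2 fun q => ?_
  obtain ⟨c, -, hq, K, hK⟩ := hf q
  have h1 : ContinuousAt (f ∘ c.symm) (c q) :=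
    hK.continuousOn.continuousAt (c.open_target.mem_nhds (c.map_source hq))
  refine (h1.comp (c.continuousAt hq)).congr ?_
  filter_upwards [c.open_source.mem_nhds hq] with z hz
  simp [c.left_inv hz]

theorem tendsto_clm_apply {α V V' : Type*} [NormedAddCommGroup V] [NormedSpace ℝ V]
    [NormedAddCommGroup V'] [NormedSpace ℝ V'] {l : Filter α} {T : α → V →L[ℝ] V'} {v : α → V}
    {T₀ : V →L[ℝ] V'} {v₀ : V} (hT : Tendsto T l (𝓝 T₀)) (hv : Tendsto v l (𝓝 v₀)) :
    Tendsto (fun x => T x (v x)) l (𝓝 (T₀ v₀)) :=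
  (isBoundedBilinearMap_apply.continuous.tendsto (T₀, v₀)).comp (hT.prodMk_nhds hv)

/-! ### Limits of approximate multipliers -/

section Multipliers

variable {EQ : Type*} [NormedAddCommGroup EQ] [NormedSpace ℝ EQ]
  {Q : Type*} [TopologicalSpace Q] [ChartedSpace EQ Q] [IsManifold 𝓘(ℝ, EQ) ∞ Q]

/-- A common subsequence along which finitely many sequences of limiting subgradients converge. -/
theorem exists_subseq_covectorTendsto {ι : Type*} [Fintype ι]
    {g : ContMDiffRiemannianMetric 𝓘(ℝ, EQ) ∞ EQ (fun q : Q => TangentSpace 𝓘(ℝ, EQ) q)}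
    {φ : ι → Q → ℝ} {x₀ : ι → Q} (hreg : ∀ i, IsPhiRegularAt g (φ i) (x₀ i))
    {x : ℕ → ι → Q} {p : ∀ k i, Covector EQ (x k i)}
    (hx : ∀ i, Tendsto (fun k => x k i) atTop (𝓝 (x₀ i)))
    (hp : ∀ k i, p k i ∈ limitingSubdiff (φ i) (x k i)) :
    ∃ s : ℕ → ℕ, StrictMono s ∧ ∃ a : ∀ i, Covector EQ (x₀ i),
      (∀ i, a i ∈ limitingSubdiff (φ i) (x₀ i)) ∧
      ∀ i, CovectorTendsto (fun k => x (s k) i) (fun k => p (s k) i) (x₀ i) (a i) := by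
  classical
  suffices h : ∀ S : Finset ι, ∃ s : ℕ → ℕ, StrictMono s ∧ ∀ i ∈ S, ∃ a : Covector EQ (x₀ i),
      a ∈ limitingSubdiff (φ i) (x₀ i) ∧
      CovectorTendsto (fun k => x (s k) i) (fun k => p (s k) i) (x₀ i) a by
    obtain ⟨s, hs, h⟩ := h Finset.univ
    choose a ha ha' using fun i => h i (Finset.mem_univ i)
    exact ⟨s, hs, a, ha, ha'⟩
  intro S
  induction S using Finset.induction_on with
  | empty => exact ⟨id, strictMono_id, by simp⟩
  | insert j S hj ih =>
    obtain ⟨s, hs, h⟩ := ih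
    obtain ⟨a, s', ha, hs', ha'⟩ := (hreg j).subseq (fun k => x (s k) j) (fun k => p (s k) j)
      ((hx j).comp hs.tendsto_atTop) (fun k => hp (s k) j)
    refine ⟨s ∘ s', hs.comp hs', fun i hi => ?_⟩
    rcases Finset.mem_insert.1 hi with rfl | hi
    · exact ⟨a, ha, ha'⟩
    · obtain ⟨b, hb, hb'⟩ := h i hi
      exact ⟨b, hb, Tendsto.comp hb' hs'.tendsto_atTop⟩

variable [FiniteDimensional ℝ EQ] [T2Space Q]

/-- Multipliers for a sequence of penalized problems whose minimizers converge. -/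
theorem exists_multipliers_of_tendsto_minimizers {ι W : Type*} [Fintype ι]
    [NormedAddCommGroup W] [NormedSpace ℝ W] [FiniteDimensional ℝ W]
    {g : ContMDiffRiemannianMetric 𝓘(ℝ, EQ) ∞ EQ (fun q : Q => TangentSpace 𝓘(ℝ, EQ) q)}
    {φ : ι → Q → ℝ} (hφ : ∀ i, Continuous (φ i)) {x₀ : ι → Q}
    (hreg : ∀ i, IsPhiRegularAt g (φ i) (x₀ i))
    {K : Set W} (hK : IsCompact K) (hKc : Convex ℝ K) {w₀ : W} (hw₀ : w₀ ∈ K)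
    {h : W → ℝ} {h' : W → W →L[ℝ] ℝ} (hh : ∀ u ∈ K, HasFDerivWithinAt h (h' u) K u)
    (hh' : ContinuousWithinAt h' K w₀)
    {y : ι → W → EQ} {y' : ι → W → W →L[ℝ] EQ}
    (hy : ∀ i, ∀ u ∈ K, HasFDerivWithinAt (y i) (y' i u) K u)
    (hy' : ∀ i, ContinuousWithinAt (y' i) K w₀)
    (hy₀ : ∀ i, y i w₀ = extChartAt 𝓘(ℝ, EQ) (x₀ i) (x₀ i))
    {B : ι → Set EQ} (hB : ∀ i, IsCompact (B i))
    (hBt : ∀ i, B i ⊆ (extChartAt 𝓘(ℝ, EQ) (x₀ i)).target)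
    (hyB : ∀ i, ∀ u ∈ K, y i u ∈ interior (B i))
    {κ : ℝ} (hκ : 0 < κ) {lam : ℕ → ℝ} {lam₀ : ℝ} (hlam : Tendsto lam atTop (𝓝 lam₀))
    {w : ℕ → W} (hw : ∀ m, w m ∈ K) (hwlim : Tendsto w atTop (𝓝 w₀))
    (hmin : ∀ m, IsMinOn (fun u => lam m * h u +
      κ * ∑ i, φ i ((extChartAt 𝓘(ℝ, EQ) (x₀ i)).symm (y i u))) K (w m)) :
    ∃ a : ∀ i, Covector EQ (x₀ i), (∀ i, a i ∈ limitingSubdiff (φ i) (x₀ i)) ∧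
      ((∀ m, ∃ i, 0 < φ i ((extChartAt 𝓘(ℝ, EQ) (x₀ i)).symm (y i (w m)))) → ∃ i, a i ≠ 0) ∧
      ∀ v ∈ K, 0 ≤ lam₀ * h' w₀ (v - w₀) + κ * ∑ i, a i (y' i w₀ (v - w₀) : EQ) := by
  set c := fun i => extChartAt 𝓘(ℝ, EQ) (x₀ i) with hc
  set ψ : ι → EQ → ℝ := fun i z => φ i ((c i).symm z) with hψ
  have hψc : ∀ i, ContinuousOn (ψ i) (c i).target := fun i =>
    (hφ i).comp_continuousOn (continuousOn_extChartAt_symm (x₀ i))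
  have hyt : ∀ i, ∀ u ∈ K, y i u ∈ (c i).target := fun i u hu =>
    hBt i (interior_subset (hyB i u hu))
  -- The tolerances also shrink so fast that a constraint violated at `w m` stays violated at the
  -- nearby point carrying its subgradient, where part (a) of regularity is applied.
  have hε : ∀ m : ℕ, ∃ ε > 0, ε ≤ 1 / ((m : ℝ) + 1) ∧ ∀ i, 0 < ψ i (y i (w m)) →
      ∀ z, dist z (y i (w m)) < ε → 0 < ψ i z := by
    intro m
    have h1 : ∀ i, ∀ᶠ r in 𝓝[>] (0 : ℝ), 0 < ψ i (y i (w m)) →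
        ∀ z ∈ univ ∩ Metric.closedBall (y i (w m)) r, 0 < ψ i z := by
      intro i
      by_cases hi : 0 < ψ i (y i (w m))
      · have hca : ContinuousAt (ψ i) (y i (w m)) :=
          (hψc i).continuousAt ((isOpen_extChartAt_target (x₀ i)).mem_nhds (hyt i _ (hw m)))
        have h2 : ∀ᶠ z in 𝓝[univ] (y i (w m)), 0 < ψ i z := by
          rw [nhdsWithin_univ]
          exact hca.eventually_const_lt hi
        filter_upwards [eventually_forall_mem_inter_closedBall h2] with r hr _ using hr
      · exact .of_forall fun r h => absurd h hi
    have hm : (0 : ℝ) < 1 / ((m : ℝ) + 1) := by positivity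
    obtain ⟨ε, h2, h3⟩ := ((eventually_all.2 h1).and (Ioo_mem_nhdsGT hm)).exists
    exact ⟨ε, h3.1, h3.2.le, fun i hi z hz => h2 i hi z ⟨trivial, hz.le⟩⟩
  choose ε hε0 hε1 hεψ using hε
  have hεlim : Tendsto ε atTop (𝓝 0) :=
    squeeze_zero (fun m => (hε0 m).le) hε1 tendsto_one_div_add_atTop_nhds_zero_nat
  have hfuzzy := fun m => exists_fuzzy_multipliers hK hKc
    (fun u hu => (hh u hu).const_mul (lam m)) hy hB
    (fun i => (hψc i).mono (hBt i)) hyB hκ (hw m) (hmin m) (hε0 m)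
  choose u hu hud x a hxB hxd hsub hineq using hfuzzy
  have hulim : Tendsto u atTop (𝓝 w₀) := by
    refine tendsto_iff_dist_tendsto_zero.2 (squeeze_zero (fun _ => dist_nonneg)
      (fun m => (dist_triangle (u m) (w m) w₀).trans (add_le_add_left (hud m).le _)) ?_)
    simpa using hεlim.add (tendsto_iff_dist_tendsto_zero.1 hwlim)
  have huK : Tendsto u atTop (𝓝[K] w₀) :=
    tendsto_nhdsWithin_iff.2 ⟨hulim, .of_forall hu⟩
  have hwK : Tendsto w atTop (𝓝[K] w₀) :=
    tendsto_nhdsWithin_iff.2 ⟨hwlim, .of_forall hw⟩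
  have hxlim : ∀ i, Tendsto (fun m => x m i) atTop (𝓝 (c i (x₀ i))) := by
    intro i
    have h1 : Tendsto (fun m => y i (w m)) atTop (𝓝 (c i (x₀ i))) := by
      rw [← hy₀ i]
      exact (hy i w₀ hw₀).continuousWithinAt.tendsto.comp hwK
    refine tendsto_iff_dist_tendsto_zero.2 (squeeze_zero (fun _ => dist_nonneg)
      (fun m => (dist_triangle (x m i) (y i (w m)) _).trans (add_le_add_left (hxd m i).le _)) ?_)
    simpa using hεlim.add (tendsto_iff_dist_tendsto_zero.1 h1)
  have hxt : ∀ m i, x m i ∈ (c i).target := fun m i => hBt i (interior_subset (hxB m i))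
  set X : ℕ → ι → Q := fun m i => (c i).symm (x m i) with hX
  have hXs : ∀ m i, X m i ∈ (chartAt EQ (x₀ i)).source := fun m i => by
    rw [← extChartAt_source 𝓘(ℝ, EQ)]
    exact (c i).map_target (hxt m i)
  have hcX : ∀ m i, c i (X m i) = x m i := fun m i => (c i).right_inv (hxt m i)
  have hXlim : ∀ i, Tendsto (fun m => X m i) atTop (𝓝 (x₀ i)) := by
    intro i
    have h1 := (continuousAt_extChartAt_symm (I := 𝓘(ℝ, EQ)) (x₀ i)).tendsto.comp (hxlim i)
    rwa [extChartAt_to_inv] at h1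
  set p : ∀ m i, Covector EQ (X m i) := fun m i => covectorOfCoord (x₀ i) (X m i) (a m i) with hp
  have hpF : ∀ m i, p m i ∈ limitingSubdiff (φ i) (X m i) := by
    intro m i
    obtain ⟨G, hG, hGa, hGmin⟩ := hsub m i
    rw [← hcX m i] at hGa hGmin
    exact frechetSubdiff_subset_limitingSubdiff _ _
      (covectorOfCoord_mem_frechetSubdiff (hXs m i) hG hGa hGmin)
  obtain ⟨s, hs, b, hb, hbt⟩ := exists_subseq_covectorTendsto hreg hXlim hpF
  -- At the centre of its own chart a covector is its own coordinate vector; `β` is `b` read in the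
  -- model space.
  obtain ⟨β, hβ⟩ : ∃ β : ι → EQ →L[ℝ] ℝ, ∀ i, covectorOfCoord (x₀ i) (x₀ i) (β i) = b i :=
    ⟨b, fun i => covectorOfCoord_self (EQ := EQ) (x₀ i) (b i)⟩
  have hβb : ∀ i, b i = β i := fun i => (hβ i).symm.trans (covectorOfCoord_self (x₀ i) (β i))
  have hab : ∀ i, Tendsto (fun m => a (s m) i) atTop (𝓝 (β i)) := fun i =>
    CovectorTendsto.tendsto_coord ((congrArg (CovectorTendsto _ _ (x₀ i)) (hβ i)).mpr (hbt i))
  have hst := hs.tendsto_atTop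
  refine ⟨b, hb, fun hpos => ?_, fun v hv => ?_⟩
  -- If every limit vanished, all coordinates would tend to `0`, and the norms would eventually be
  -- below every `Δ`. Then no constraint could be violated at `X (s m)`, yet one always is.
  · by_contra! hb0
    have hev : ∀ i, ∀ᶠ m in atTop, ¬ 0 < φ i (X (s m) i) := by
      intro i
      obtain ⟨Δ, hΔ, hΔ'⟩ := (hreg i).norm_ge
      obtain ⟨M, hM⟩ := exists_covectorNorm_covectorOfCoord_le g (x₀ i)
      have h1 : Tendsto (fun m => M * ‖a (s m) i‖) atTop (𝓝 0) := by
        have h2 := (hab i).norm.const_mul M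
        have h3 : ‖β i‖ = 0 := norm_eq_zero.2 ((hβb i).symm.trans (hb0 i))
        rwa [h3, mul_zero] at h2
      filter_upwards [h1.eventually_lt_const hΔ, ((hXlim i).comp hst).eventually hΔ',
        ((hXlim i).comp hst).eventually hM] with m h4 h5 h6 h7
      exact absurd ((h5 h7 _ (hpF (s m) i)).trans (h6 (a (s m) i))) (not_le.2 h4)
    obtain ⟨m, hm⟩ := (eventually_all.2 hev).exists
    obtain ⟨i, hi⟩ := hpos (s m)
    exact hm i (hεψ (s m) i hi _ (hxd (s m) i))
  · have hu' := huK.comp hst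
    have hvu : Tendsto (fun m => v - u (s m)) atTop (𝓝 (v - w₀)) :=
      tendsto_const_nhds.sub (hulim.comp hst)
    have h1 : Tendsto (fun m => -(ε (s m) * ‖v - u (s m)‖)) atTop (𝓝 0) := by
      simpa using ((hεlim.comp hst).mul hvu.norm).neg
    have h2 : Tendsto (fun m => lam (s m) * h' (u (s m)) (v - u (s m)) +
        κ * ∑ i, a (s m) i (y' i (u (s m)) (v - u (s m)))) atTop
        (𝓝 (lam₀ * h' w₀ (v - w₀) + κ * ∑ i, β i (y' i w₀ (v - w₀)))) := by
      have e1 : Tendsto (fun m => h' (u (s m))) atTop (𝓝 (h' w₀)) := hh'.tendsto.comp hu'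
      refine ((hlam.comp hst).mul (tendsto_clm_apply e1 hvu)).add
        (Tendsto.const_mul κ (tendsto_finsetSum _ fun i _ => ?_))
      have e2 : Tendsto (fun m => y' i (u (s m))) atTop (𝓝 (y' i w₀)) :=
        (hy' i).tendsto.comp hu'
      exact tendsto_clm_apply (hab i) (tendsto_clm_apply e2 hvu)
    have h3 : ∑ i, b i (y' i w₀ (v - w₀) : EQ) = ∑ i, β i (y' i w₀ (v - w₀)) :=
      Finset.sum_congr rfl fun i _ => congrArg (fun T : EQ →L[ℝ] ℝ => T (y' i w₀ (v - w₀))) (hβb i)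
    rw [h3]
    exact le_of_tendsto_of_tendsto' h1 h2 fun m => by simpa using hineq (s m) v hv

end Multipliers

/-! ### The multiplier rule for constrained minimizers -/

section Multipliers

variable {EQ : Type*} [NormedAddCommGroup EQ] [NormedSpace ℝ EQ] [FiniteDimensional ℝ EQ]
  {Q : Type*} [TopologicalSpace Q] [ChartedSpace EQ Q] [IsManifold 𝓘(ℝ, EQ) ∞ Q] [T2Space Q]

/-- A multiplier rule for a `C¹` problem with convex control set and constraints
`φ i (q i u) = 0`, regular at the minimizer. -/
theorem exists_multipliers {ι W : Type*} [Fintype ι]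
    [NormedAddCommGroup W] [NormedSpace ℝ W] [FiniteDimensional ℝ W]
    {g : ContMDiffRiemannianMetric 𝓘(ℝ, EQ) ∞ EQ (fun q : Q => TangentSpace 𝓘(ℝ, EQ) q)}
    {φ : ι → Q → ℝ} (hφ : ∀ i, Continuous (φ i)) (hφ0 : ∀ i q, 0 ≤ φ i q)
    {C : Set W} (hC : Convex ℝ C) {w₀ : W} (hw₀ : w₀ ∈ C)
    (hCc : ∀ᶠ r in 𝓝[>] (0 : ℝ), IsCompact (C ∩ Metric.closedBall w₀ r))
    {q : ι → W → Q} (hq : ∀ i, ContMDiffOn 𝓘(ℝ, W) 𝓘(ℝ, EQ) 1 (q i) C)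
    {h : W → ℝ} (hh : ContDiffOn ℝ 1 h C)
    (hφw₀ : ∀ i, φ i (q i w₀) = 0)
    (hmin : ∀ u ∈ C, (∀ i, φ i (q i u) = 0) → h w₀ ≤ h u)
    (hreg : ∀ i, IsPhiRegularAt g (φ i) (q i w₀)) :
    ∃ (lam κ : ℝ) (a : ∀ i, Covector EQ (q i w₀)), (lam = 0 ∨ lam = 1) ∧ 0 < κ ∧
      (lam = 0 → κ = 1) ∧ (∀ i, a i ∈ limitingSubdiff (φ i) (q i w₀)) ∧
      (lam = 1 ∨ ∃ i, a i ≠ 0) ∧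
      ∀ v ∈ C, ∀ (δ : ℝ) (ξ : ι → EQ),
        HasDerivWithinAt (fun t : ℝ => h (w₀ + t • (v - w₀))) δ (Icc 0 1) 0 →
        (∀ i, HasInitialVelocity (fun t : ℝ => q i (w₀ + t • (v - w₀))) (q i w₀) (ξ i)) →
        0 ≤ lam * δ + κ * ∑ i, a i (ξ i) := by
  set c := fun i => extChartAt 𝓘(ℝ, EQ) (q i w₀) with hc
  set y : ι → W → EQ := fun i u => c i (q i u) with hydef
  have hyC : ∀ i, ContDiffWithinAt ℝ 1 (y i) C w₀ := fun i =>
    ((contMDiffAt_extChartAt (n := 1)).comp_contMDiffWithinAt w₀ (hq i w₀ hw₀)).contDiffWithinAt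
  obtain ⟨h', hh'c, hh'⟩ := (hh w₀ hw₀).exists_hasFDerivWithinAt_ball hw₀
  choose y' hy'c hy' using fun i => (hyC i).exists_hasFDerivWithinAt_ball hw₀
  have hρ : ∀ i, ∃ ρ > 0, Metric.closedBall (c i (q i w₀)) ρ ⊆ (c i).target := fun i =>
    Metric.nhds_basis_closedBall.mem_iff.1 (extChartAt_target_mem_nhds (q i w₀))
  choose ρ hρ0 hρt using hρ
  have hyB : ∀ i, ∀ᶠ r in 𝓝[>] (0 : ℝ), ∀ u ∈ C ∩ Metric.closedBall w₀ r,
      q i u ∈ (c i).source ∧ y i u ∈ Metric.ball (c i (q i w₀)) (ρ i) := fun i =>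
    eventually_forall_mem_inter_closedBall
      (((hq i w₀ hw₀).continuousWithinAt.eventually (extChartAt_source_mem_nhds (q i w₀))).and
        ((hyC i).continuousWithinAt.eventually (Metric.ball_mem_nhds _ (hρ0 i))))
  obtain ⟨r, hr, hK, hh', hy', hyB⟩ := ((eventually_mem_nhdsWithin (a := (0 : ℝ)) (s := Ioi 0)).and
    (hCc.and (hh'.and ((eventually_all.2 hy').and (eventually_all.2 hyB))))).exists
  set K := C ∩ Metric.closedBall w₀ r with hKdef
  have hKC : K ⊆ C := inter_subset_left
  have hw₀K : w₀ ∈ K := ⟨hw₀, Metric.mem_closedBall_self hr.le⟩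
  have hKc : Convex ℝ K := hC.inter (convex_closedBall w₀ r)
  -- The square makes `w₀` the strict minimizer among feasible points of `K`, and its derivative
  -- vanishes at `w₀`.
  set H : W → ℝ := fun u => h u + euclSq (u - w₀) with hHdef
  set H' : W → W →L[ℝ] ℝ := fun u => h' u + fderiv ℝ euclSq (u - w₀) with hH'def
  have hH : ∀ u ∈ K, HasFDerivWithinAt H (H' u) K u := fun u hu =>
    (hh' u hu).add (hasFDerivAt_euclSq_sub_const u w₀).hasFDerivWithinAt
  have hH'c : ContinuousWithinAt H' K w₀ := (hh'c.mono hKC).add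
    (continuous_fderiv_euclSq.comp (continuous_id.sub continuous_const)).continuousWithinAt
  have hH'w₀ : H' w₀ = h' w₀ := by simp [hH'def, fderiv_euclSq_zero]
  have hHc : ContinuousOn H K := fun u hu => (hH u hu).continuousWithinAt
  set P : W → ℝ := fun u => ∑ i, φ i (q i u) with hPdef
  have hPc : ContinuousOn P K := continuousOn_finsetSum _ fun i _ =>
    (hφ i).comp_continuousOn ((hq i).continuousOn.mono hKC)
  have hP0 : ∀ u, 0 ≤ P u := fun u => Finset.sum_nonneg fun i _ => hφ0 i _
  have hPeq : ∀ u, P u = 0 → ∀ i, φ i (q i u) = 0 := fun u hu i =>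
    (Finset.sum_eq_zero_iff_of_nonneg fun i _ => hφ0 i _).1 hu i (Finset.mem_univ i)
  have hPw₀ : P w₀ = 0 := Finset.sum_eq_zero fun i _ => hφw₀ i
  have hHw₀ : H w₀ = h w₀ := by simp [hHdef]
  have hHlt : ∀ u ∈ K, P u = 0 → u ≠ w₀ → H w₀ < H u := fun u hu hPu hne => by
    have h1 := hmin u (hKC hu) (hPeq u hPu)
    have h2 := euclSq_pos (sub_ne_zero.2 hne)
    rw [hHw₀]
    exact lt_add_of_le_of_pos h1 h2
  have hφy : ∀ i, ∀ u ∈ K, φ i ((c i).symm (y i u)) = φ i (q i u) := fun i u hu => by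
    rw [hydef, (c i).left_inv (hyB i u hu).1]
  have hsum : ∀ u ∈ K, ∑ i, φ i ((c i).symm (y i u)) = P u := fun u hu =>
    Finset.sum_congr rfl fun i _ => hφy i u hu
  have hex : ∀ k : ℕ, ∃ u ∈ K, IsMinOn (fun u => H u + (k : ℝ) * P u) K u := fun k =>
    hK.exists_isMinOn ⟨w₀, hw₀K⟩ (hHc.add (continuousOn_const.mul hPc))
  choose w hwK hwmin using hex
  have hwlim : Tendsto w atTop (𝓝 w₀) := fun N hN => by
    show ∀ᶠ k in atTop, w k ∈ N
    filter_upwards [tendsto_natCast_atTop_atTop.eventually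
      (hK.eventually_penalty_minimizer_mem hHc hPc (fun u _ => hP0 u) hw₀K hPw₀ hHlt hN)] with k hk
    exact hk (w k) (hwK k) (hwmin k)
  -- the two cases share the passage to the limit
  have main : ∀ (κ : ℝ) (lam : ℕ → ℝ) (lam₀ : ℝ) (z : ℕ → W), 0 < κ → Tendsto lam atTop (𝓝 lam₀) →
      (∀ m, z m ∈ K) → Tendsto z atTop (𝓝 w₀) →
      (∀ m, IsMinOn (fun u => lam m * H u + κ * P u) K (z m)) →
      ∃ a : ∀ i, Covector EQ (q i w₀), (∀ i, a i ∈ limitingSubdiff (φ i) (q i w₀)) ∧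
        ((∀ m, 0 < P (z m)) → ∃ i, a i ≠ 0) ∧
        ∀ v ∈ C, ∀ (δ : ℝ) (ξ : ι → EQ),
          HasDerivWithinAt (fun t : ℝ => h (w₀ + t • (v - w₀))) δ (Icc 0 1) 0 →
          (∀ i, HasInitialVelocity (fun t : ℝ => q i (w₀ + t • (v - w₀))) (q i w₀) (ξ i)) →
          0 ≤ lam₀ * δ + κ * ∑ i, a i (ξ i) := by
    intro κ lam lam₀ z hκ hlam hzK hzlim hzmin
    obtain ⟨a, ha, hane, hineq⟩ := exists_multipliers_of_tendsto_minimizers hφ hreg hK hKc hw₀K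
      hH hH'c hy' (fun i => (hy'c i).mono hKC) (fun i => rfl)
      (B := fun i => Metric.closedBall (c i (q i w₀)) (ρ i)) (fun i => isCompact_closedBall _ _)
      hρt (fun i u hu => Metric.ball_subset_interior_closedBall (hyB i u hu).2) hκ hlam hzK hzlim
      (fun m u hu => by
        have := hzmin m hu
        simp only [mem_ofPred_eq] at this ⊢
        rw [hsum u hu, hsum _ (hzK m)]
        exact this)
    refine ⟨a, ha, fun hpos => hane fun m => ?_, fun v hv δ ξ hδ hξ => ?_⟩
    · by_contra! hle
      exact (hpos m).ne' (Finset.sum_eq_zero fun i _ =>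
        le_antisymm ((hφy i _ (hzK m)) ▸ hle i) (hφ0 i _))
    · obtain ⟨t₀, ht₀, ht₁, hline⟩ : ∃ t₀ > 0, t₀ ≤ 1 ∧
          ∀ t ∈ Icc (0 : ℝ) t₀, w₀ + t • (v - w₀) ∈ K := by
        -- `v` may lie outside the ball, so only an initial piece of the segment is in `K`. The
        -- inequality is homogeneous in the direction, and the factor `t₀` cancels at the end. The
        -- `+ 1` avoids a zero denominator.
        refine ⟨min 1 (r / (‖v - w₀‖ + 1)), lt_min one_pos (div_pos hr (by positivity)), min_le_left _ _, fun t ht => ?_⟩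
        have ht1 : t ≤ 1 := ht.2.trans (min_le_left _ _)
        have ht2 : t ≤ r / (‖v - w₀‖ + 1) := ht.2.trans (min_le_right _ _)
        refine ⟨hC.add_smul_sub_mem hw₀ hv ⟨ht.1, ht1⟩, ?_⟩
        rw [Metric.mem_closedBall, dist_eq_norm, add_sub_cancel_left, norm_smul,
          Real.norm_of_nonneg ht.1]
        rw [le_div_iff₀ (by positivity)] at ht2
        nlinarith [norm_nonneg (v - w₀), ht.1]
      have h1 : h' w₀ (v - w₀) = δ :=
        (hh' w₀ hw₀K).apply_eq_of_hasDerivWithinAt_line ht₀ ht₁ hline hδ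
      have h2 : ∀ i, y' i w₀ (v - w₀) = ξ i := fun i =>
        (hy' i w₀ hw₀K).apply_eq_of_hasDerivWithinAt_line ht₀ ht₁ hline (hξ i).hasDerivWithinAt
      have h3 := hineq _ (hline t₀ ⟨ht₀.le, le_rfl⟩)
      rw [add_sub_cancel_left, hH'w₀] at h3
      simp only [map_smul, h1, h2, smul_eq_mul] at h3
      have h4 : lam₀ * (t₀ * δ) + κ * ∑ i, a i (t₀ • ξ i : EQ) =
          t₀ * (lam₀ * δ + κ * ∑ i, a i (ξ i)) := by
        have h5 : ∑ i, a i (t₀ • ξ i : EQ) = t₀ * ∑ i, a i (ξ i) := by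
          rw [Finset.mul_sum]
          exact Finset.sum_congr rfl fun i _ => (a i).map_smul t₀ _
        rw [h5]
        ring
      rw [h4] at h3
      exact nonneg_of_mul_nonneg_right h3 ht₀
  by_cases hP : ∃ k : ℕ, 0 < k ∧ P (w k) = 0
  · obtain ⟨k, hk, hPk⟩ := hP
    -- A feasible minimizer has `H (w k) ≤ H w₀`, so strictness forces it to be `w₀`: the penalty
    -- with weight `k` is exact.
    have hwk : w k = w₀ := by
      by_contra hne
      have h1 : H (w k) + k * P (w k) ≤ H w₀ + k * P w₀ := hwmin k hw₀K
      rw [hPk, hPw₀] at h1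
      linarith [hHlt _ (hwK k) hPk hne]
    obtain ⟨a, ha, -, hineq⟩ := main k (fun _ => 1) 1 (fun _ => w₀) (by exact_mod_cast hk)
      tendsto_const_nhds (fun _ => hw₀K) tendsto_const_nhds
      (fun _ => by simpa [hwk] using hwmin k)
    exact ⟨1, k, a, .inr rfl, by exact_mod_cast hk, by simp, ha, .inl rfl, hineq⟩
  · push Not at hP
    -- The penalized functional of weight `m + 1` is divided by `m + 1`; the shift skips the weight
    -- `0`.
    obtain ⟨a, ha, hane, hineq⟩ := main 1 (fun m => 1 / ((m : ℝ) + 1)) 0 (fun m => w (m + 1))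
      one_pos tendsto_one_div_add_atTop_nhds_zero_nat (fun m => hwK _)
      (hwlim.comp (tendsto_add_atTop_nat 1)) (fun m u hu => by
        have h1 : H (w (m + 1)) + ((m + 1 : ℕ) : ℝ) * P (w (m + 1)) ≤
          H u + ((m + 1 : ℕ) : ℝ) * P u := hwmin (m + 1) hu
        have hm : (0 : ℝ) < (m : ℝ) + 1 := by positivity
        push_cast at h1
        have h2 := mul_le_mul_of_nonneg_left h1 (one_div_pos.2 hm).le
        have h3 : ∀ x z : ℝ, 1 / ((m : ℝ) + 1) * (x + (m + 1) * z) = 1 / ((m : ℝ) + 1) * x + 1 * z :=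
          fun x z => by field_simp
        rwa [h3, h3] at h2)
    exact ⟨0, 1, a, .inl rfl, one_pos, fun _ => rfl, ha,
      .inr (hane fun m => (hP0 _).lt_of_ne (hP _ m.succ_pos).symm), hineq⟩

end Multipliers

/-! ### Adjoint equation and variations of the states -/

/-- Pairing the adjoint equation with a variation of the states that starts after the time `i`. -/
theorem adjoint_apply_variation {V : Type*} [NormedAddCommGroup V] [NormedSpace ℝ V] {n : ℕ}
    {P A : Fin (n + 1) → V →L[ℝ] ℝ} {T : Fin n → V →L[ℝ] V} {dL : Fin n → V →L[ℝ] ℝ}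
    {dl : V →L[ℝ] ℝ} {ξ : Fin (n + 1) → V} {i : Fin n} {lam κ : ℝ}
    (hlast : -P (Fin.last n) = lam • dl + κ • A (Fin.last n))
    (hadj : ∀ j : Fin n, 0 < (j : ℕ) →
      -P j.castSucc + (P j.succ).comp (T j) = lam • dL j + κ • A j.castSucc)
    (hξ0 : ∀ j ≤ i.castSucc, ξ j = 0) (hξ : ∀ j, i < j → ξ j.succ = T j (ξ j.castSucc)) :
    P i.succ (ξ i.succ) = -(lam * (∑ j, dL j (ξ j.castSucc) + dl (ξ (Fin.last n))) +
      κ * ∑ j : Fin n, A j.succ (ξ j.succ)) := by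
  -- The increments of `P j (ξ j)` telescope. Before time `i` they vanish, at `i` the control
  -- injects the whole value `P i.succ (ξ i.succ)`, and afterwards the adjoint equation gives them.
  have hterm : ∀ j : Fin n, P j.succ (ξ j.succ) - P j.castSucc (ξ j.castSucc) =
      lam * dL j (ξ j.castSucc) + κ * A j.castSucc (ξ j.castSucc) +
        if j = i then P i.succ (ξ i.succ) else 0 := by
    intro j
    rcases lt_trichotomy j i with hji | rfl | hij
    · rw [hξ0 j.castSucc (Fin.castSucc_le_castSucc_iff.2 hji.le),
        hξ0 j.succ (Fin.succ_le_castSucc_iff.2 hji)]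
      simp [hji.ne]
    · simp [hξ0 j.castSucc le_rfl]
    · have h := congrArg (fun D : V →L[ℝ] ℝ => D (ξ j.castSucc))
        (hadj j (lt_of_le_of_lt (Nat.zero_le _) hij))
      simp only [_root_.add_apply, _root_.neg_apply, _root_.smul_apply,
        ContinuousLinearMap.comp_apply, smul_eq_mul] at h
      rw [hξ j hij, if_neg hij.ne']
      linarith
  -- Since `ξ 0 = 0`, shifting the index costs only the endpoint term, and the values of `P` and `A`
  -- at `0` do not matter.
  have htel : ∀ G : Fin (n + 1) → ℝ, G 0 = 0 →
      ∑ j : Fin n, G j.succ = ∑ j : Fin n, G j.castSucc + G (Fin.last n) := fun G hG => by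
    rw [← Fin.sum_univ_castSucc, Fin.sum_univ_succ, hG, zero_add]
  have h0 : ξ 0 = 0 := hξ0 0 (Fin.zero_le _)
  have hsum := Finset.sum_congr rfl fun j (_ : j ∈ Finset.univ) => hterm j
  rw [Finset.sum_sub_distrib, Finset.sum_add_distrib, Finset.sum_add_distrib, ← Finset.mul_sum,
    ← Finset.mul_sum, Finset.sum_ite_eq' Finset.univ i, if_pos (Finset.mem_univ i),
    htel (fun j => P j (ξ j)) (by simp [h0])] at hsum
  rw [htel (fun j => A j (ξ j)) (by simp [h0])]
  have h := congrArg (fun D : V →L[ℝ] ℝ => D (ξ (Fin.last n))) hlast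
  simp only [_root_.add_apply, _root_.neg_apply, _root_.smul_apply, smul_eq_mul] at h
  linarith

/-- The one-sided derivative of a convex function along a segment is at most the increment. -/
theorem ConvexOn.deriv_line_le {W : Type*} [AddCommGroup W] [Module ℝ W] {C : Set W} {G : W → ℝ}
    (hG : ConvexOn ℝ C G) {u v : W} (hu : u ∈ C) (hv : v ∈ C) {δ : ℝ}
    (hδ : HasDerivWithinAt (fun t : ℝ => G ((1 - t) • u + t • v)) δ (Icc 0 1) 0) :
    δ ≤ G v - G u := by
  have h1 : Tendsto (fun t : ℝ => (t - 0)⁻¹ * (G ((1 - t) • u + t • v) -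
      G ((1 - 0 : ℝ) • u + (0 : ℝ) • v))) (𝓝[>] 0) (𝓝 δ) := by
    have := hasDerivWithinAt_iff_tendsto_slope.1 hδ
    rw [Icc_sdiff_left] at this
    rw [nhdsWithin_Ioc_eq_nhdsGT one_pos] at this
    exact this
  refine le_of_tendsto h1 ?_
  filter_upwards [Ioo_mem_nhdsGT (one_pos (α := ℝ))] with t ht
  have h2 := hG.2 hu hv (sub_nonneg.2 ht.2.le) ht.1.le (sub_add_cancel 1 t)
  simp only [smul_eq_mul] at h2
  rw [sub_zero, sub_zero, one_smul, zero_smul, add_zero, inv_mul_le_iff₀ ht.1]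
  linarith

theorem stateSeq_congr {Q : Type*} {n : ℕ} {W : Fin n → Type*} {F : ∀ i : Fin n, Q → W i → Q} {q₀ : Q} {u u' : ∀ i, W i}
    (j : Fin (n + 1)) (h : ∀ k : Fin n, k.castSucc < j → u k = u' k) :
    stateSeq F q₀ u j = stateSeq F q₀ u' j := by
  induction j using Fin.induction with
  | zero => rfl
  | succ j ih =>
    show F j (stateSeq F q₀ u j.castSucc) (u j) = F j (stateSeq F q₀ u' j.castSucc) (u' j)
    rw [ih fun k hk => h k (hk.trans Fin.castSucc_lt_succ), h j Fin.castSucc_lt_succ]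

section ControlSystem

variable {EQ : Type*} [NormedAddCommGroup EQ] [NormedSpace ℝ EQ]
  {Q : Type*} [TopologicalSpace Q] [ChartedSpace EQ Q] {n : ℕ} {W : Fin n → Type*}

/-- The velocities of the states when the control is varied at the time `i` only. -/
theorem exists_velocities {F : ∀ i : Fin n, Q → W i → Q} {q₀ : Q} {u : ∀ i, W i}
    (hF : ∀ (j : Fin n) (q : Q), MDifferentiableAt 𝓘(ℝ, EQ) 𝓘(ℝ, EQ) (fun q => F j q (u j)) q)
    {i : Fin n} {γ : ℝ → ∀ i, W i} (hγ : ∀ t, ∀ j ≠ i, γ t j = u j) {η : EQ}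
    (hη : HasInitialVelocity (fun t => F i (stateSeq F q₀ u i.castSucc) (γ t i))
      (stateSeq F q₀ u i.succ) η) :
    ∃ ξ : Fin (n + 1) → EQ,
      (∀ j, HasInitialVelocity (fun t => stateSeq F q₀ (γ t) j) (stateSeq F q₀ u j) (ξ j)) ∧
      (∀ j ≤ i.castSucc, ξ j = 0) ∧ ξ i.succ = η ∧
      ∀ j, i < j → ξ j.succ = mfderiv 𝓘(ℝ, EQ) 𝓘(ℝ, EQ) (fun q => F j q (u j))
        (stateSeq F q₀ u j.castSucc) (ξ j.castSucc) := by
  let T : Fin n → EQ →L[ℝ] EQ := fun j =>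
    mfderiv 𝓘(ℝ, EQ) 𝓘(ℝ, EQ) (fun q => F j q (u j)) (stateSeq F q₀ u j.castSucc)
  let step : Fin n → EQ → EQ := fun j x => if j < i then 0 else if j = i then η else T j x
  have hstep : ∀ j x, i < j → step j x = T j x := fun j x h =>
    (if_neg h.not_gt).trans (if_neg h.ne')
  let ξ : Fin (n + 1) → EQ := Fin.induction 0 step
  have hξ : ∀ j : Fin n, ξ j.succ = step j (ξ j.castSucc) := fun j => rfl
  have hconst : ∀ t, ∀ j ≤ i.castSucc, stateSeq F q₀ (γ t) j = stateSeq F q₀ u j :=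
    fun t j hj => stateSeq_congr j fun k hk => hγ t k fun h => by
      subst h
      exact absurd hj (not_le.2 hk)
  refine ⟨ξ, fun j => ?_, fun j hj => ?_, ?_, fun j hj => ?_⟩
  · induction j using Fin.induction with
    | zero => exact hasInitialVelocity_const q₀
    | succ j ih =>
      rw [hξ]
      rcases lt_trichotomy j i with hji | rfl | hij
      · simp only [step, if_pos hji]
        exact (hasInitialVelocity_const _).congr fun t _ =>
          hconst t j.succ (Fin.succ_le_castSucc_iff.2 hji)
      · simp only [step, lt_irrefl, if_false]
        refine hη.congr fun t _ => ?_
        show F j (stateSeq F q₀ (γ t) j.castSucc) (γ t j) = _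
        rw [hconst t _ le_rfl]
      · rw [hstep j _ hij]
        refine (ih.comp (hF j _)).congr fun t _ => ?_
        show F j (stateSeq F q₀ (γ t) j.castSucc) (γ t j) = _
        rw [hγ t j hij.ne']
  · induction j using Fin.cases with
    | zero => rfl
    | succ j => rw [hξ]; exact if_pos (Fin.succ_le_castSucc_iff.1 hj)
  · rw [hξ]; simp [step]
  · exact (hξ j).trans (hstep j _ hj)

variable [∀ i, NormedAddCommGroup (W i)] [∀ i, NormedSpace ℝ (W i)]

theorem contMDiffOn_stateSeq {U C : ∀ i, Set (W i)} (hCU : ∀ i, C i ⊆ U i)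
    {F : ∀ i : Fin n, Q → W i → Q}
    (hF : ∀ i, ContMDiffOn (𝓘(ℝ, EQ).prod 𝓘(ℝ, W i)) 𝓘(ℝ, EQ) 1
      (fun z : Q × W i => F i z.1 z.2) (univ ×ˢ U i)) (q₀ : Q) (j : Fin (n + 1)) :
    ContMDiffOn 𝓘(ℝ, ∀ i, W i) 𝓘(ℝ, EQ) 1 (fun u => stateSeq F q₀ u j) (univ.pi C) := by
  induction j using Fin.induction with
  | zero => exact contMDiffOn_const
  | succ j ih =>
    have h1 : ContMDiffOn 𝓘(ℝ, ∀ i, W i) 𝓘(ℝ, W j) 1 (fun u : ∀ i, W i => u j) (univ.pi C) :=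
      (ContinuousLinearMap.proj (R := ℝ) (φ := W) j).contMDiff.contMDiffOn
    exact (hF j).comp (ih.prodMk h1) fun u hu => ⟨trivial, hCU j (hu j trivial)⟩

theorem contDiffOn_totalCost {U C : ∀ i, Set (W i)} (hCU : ∀ i, C i ⊆ U i)
    {F : ∀ i : Fin n, Q → W i → Q}
    (hF : ∀ i, ContMDiffOn (𝓘(ℝ, EQ).prod 𝓘(ℝ, W i)) 𝓘(ℝ, EQ) 1
      (fun z : Q × W i => F i z.1 z.2) (univ ×ˢ U i)) (q₀ : Q)
    {ℓ : Q → ℝ} (hℓ : ContMDiff 𝓘(ℝ, EQ) 𝓘(ℝ, ℝ) 1 ℓ) {L : ∀ i : Fin n, Q → W i → ℝ}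
    (hL : ∀ i, ContMDiffOn (𝓘(ℝ, EQ).prod 𝓘(ℝ, W i)) 𝓘(ℝ, ℝ) 1
      (fun z : Q × W i => L i z.1 z.2) (univ ×ˢ U i)) :
    ContDiffOn ℝ 1 (totalCost F q₀ ℓ L) (univ.pi C) := by
  have hS := contMDiffOn_stateSeq hCU hF q₀
  refine ContDiffOn.add (hℓ.comp_contMDiffOn (hS (Fin.last n))).contDiffOn
    (ContDiffOn.sum fun i _ => ContMDiffOn.contDiffOn ?_)
  have h1 : ContMDiffOn 𝓘(ℝ, ∀ i, W i) 𝓘(ℝ, W i) 1 (fun u : ∀ i, W i => u i) (univ.pi C) :=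
    (ContinuousLinearMap.proj (R := ℝ) (φ := W) i).contMDiff.contMDiffOn
  exact (hL i).comp ((hS i.castSucc).prodMk h1) fun u hu => ⟨trivial, hCU i (hu i trivial)⟩

end ControlSystem

/-- Locally closed convex control sets have compact intersections with small closed balls. -/
theorem eventually_isCompact_pi_inter_closedBall {ι : Type*} [Fintype ι] {W : ι → Type*}
    [∀ i, PseudoMetricSpace (W i)] [∀ i, ProperSpace (W i)] {C : ∀ i, Set (W i)}
    (hC : ∀ i, IsLocallyClosed (C i)) {u : ∀ i, W i} (hu : u ∈ univ.pi C) :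
    ∀ᶠ r in 𝓝[>] (0 : ℝ), IsCompact (univ.pi C ∩ Metric.closedBall u r) := by
  have h1 : ∀ i, ∀ᶠ r in 𝓝[>] (0 : ℝ), IsCompact (C i ∩ Metric.closedBall (u i) r) := by
    intro i
    obtain ⟨O, D, hO, hD, hOD⟩ := hC i
    have hui : u i ∈ O := by
      have := hu i trivial
      rw [hOD] at this
      exact this.1
    -- In a ball inside the open set `O`, `C i` coincides with the closed set `D`.
    obtain ⟨r, hr, hrO⟩ := Metric.nhds_basis_closedBall.mem_iff.1 (hO.mem_nhds hui)
    filter_upwards [Ioo_mem_nhdsGT hr] with r' hr'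
    have h2 : C i ∩ Metric.closedBall (u i) r' = Metric.closedBall (u i) r' ∩ D := by
      rw [hOD]
      ext z
      exact ⟨fun h => ⟨h.2, h.1.2⟩, fun h =>
        ⟨⟨hrO (Metric.closedBall_subset_closedBall hr'.2.le h.1), h.2⟩, h.1⟩⟩
    rw [h2]
    exact (isCompact_closedBall _ _).inter_right hD
  filter_upwards [eventually_all.2 h1, eventually_mem_nhdsWithin] with r hr hr0
  have h3 : univ.pi C ∩ Metric.closedBall u r =
      univ.pi fun i => C i ∩ Metric.closedBall (u i) r := by
    rw [closedBall_pi _ (le_of_lt hr0), ← pi_inter_distrib]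
  rw [h3]
  exact isCompact_univ_pi hr

/-! ### The discrete maximum principle -/

theorem mainTheorem12
    -- the state manifold `Q`, with a Riemannian metric `g`
    {EQ : Type*} [NormedAddCommGroup EQ] [NormedSpace ℝ EQ] [FiniteDimensional ℝ EQ]
    {Q : Type*} [TopologicalSpace Q] [T2Space Q] [ChartedSpace EQ Q] [IsManifold 𝓘(ℝ, EQ) ∞ Q]
    (g : ContMDiffRiemannianMetric 𝓘(ℝ, EQ) ∞ EQ (fun q : Q => TangentSpace 𝓘(ℝ, EQ) q))
    -- the vector bundle `X → Q` and the map `E : X → Q`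
    {FX : Type*} [NormedAddCommGroup FX] [NormedSpace ℝ FX] [FiniteDimensional ℝ FX]
    {X : Q → Type*} [∀ q, AddCommGroup (X q)] [∀ q, Module ℝ (X q)] [∀ q, TopologicalSpace (X q)]
    [TopologicalSpace (TotalSpace FX X)] [FiberBundle FX X] [VectorBundle ℝ FX X]
    [ContMDiffVectorBundle ∞ FX X 𝓘(ℝ, EQ)]
    (E : TotalSpace FX X → Q)
    (hE : ContMDiff (𝓘(ℝ, EQ).prod 𝓘(ℝ, FX)) 𝓘(ℝ, EQ) 1 E)
    -- control manifolds `U i ⊆ ℝ^{k i}` (locally closed, as every embedded submanifold is; no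
    -- more is needed) and convex control sets `C i`, closed in `U i`
    {n : ℕ} (hn : 0 < n) (k : Fin n → ℕ)
    (U C : ∀ i : Fin n, Set (EuclideanSpace ℝ (Fin (k i))))
    (hU : ∀ i, IsLocallyClosed (U i))
    (hCU : ∀ i, ∃ D, IsClosed D ∧ C i = U i ∩ D)
    (hC : ∀ i, Convex ℝ (C i))
    -- the dynamics `F i`, of class `C¹` on `Q × U i`
    (F : ∀ i : Fin n, Q → EuclideanSpace ℝ (Fin (k i)) → Q)
    (hF : ∀ i, ContMDiffOn (𝓘(ℝ, EQ).prod 𝓘(ℝ, EuclideanSpace ℝ (Fin (k i)))) 𝓘(ℝ, EQ) 1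
      (fun z : Q × EuclideanSpace ℝ (Fin (k i)) => F i z.1 z.2) (univ ×ˢ U i))
    -- `F i` factors as `E ∘ f i` with `f i` affine in the control
    (f : ∀ i : Fin n, ∀ q : Q, EuclideanSpace ℝ (Fin (k i)) → X q)
    (hfac : ∀ i q, ∀ u ∈ C i, F i q u = E ⟨q, f i q u⟩)
    (hf : ∀ i q, ∀ u ∈ C i, ∀ v ∈ C i, ∀ t ∈ Icc (0 : ℝ) 1,
      f i q ((1 - t) • u + t • v) = (1 - t) • f i q u + t • f i q v)
    -- `C¹` costs, with running costs convex in the control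
    (ℓ : Q → ℝ) (hℓ : ContMDiff 𝓘(ℝ, EQ) 𝓘(ℝ, ℝ) 1 ℓ)
    (L : ∀ i : Fin n, Q → EuclideanSpace ℝ (Fin (k i)) → ℝ)
    (hL : ∀ i, ContMDiffOn (𝓘(ℝ, EQ).prod 𝓘(ℝ, EuclideanSpace ℝ (Fin (k i)))) 𝓘(ℝ, ℝ) 1
      (fun z : Q × EuclideanSpace ℝ (Fin (k i)) => L i z.1 z.2) (univ ×ˢ U i))
    (hLconv : ∀ i q, ConvexOn ℝ (C i) (L i q))
    -- the state constraints `φ_j(q_j) = 0` for `j = 1, …, n`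
    (φ : Fin (n + 1) → Q → ℝ)
    (hφ : ∀ i : Fin n, LocallyLipschitzOnManifold EQ (φ i.succ))
    (hφ_nonneg : ∀ (i : Fin n) (q : Q), 0 ≤ φ i.succ q)
    -- the optimal control `u`, along which the constraints are regular
    (q₀ : Q) (u : ∀ i : Fin n, EuclideanSpace ℝ (Fin (k i)))
    (hu : u ∈ admissible F q₀ C φ)
    (hmin : IsMinOn (totalCost F q₀ ℓ L) (admissible F q₀ C φ) u)
    (hreg : ∀ i : Fin n, IsPhiRegularAt g (φ i.succ) (stateSeq F q₀ u i.succ)) :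
    ∃ (lam : ℝ) (κ : ℝ) (p : ∀ j : Fin (n + 1), Covector EQ (stateSeq F q₀ u j)),
      (lam = 0 ∨ lam = 1) ∧ 0 < κ ∧ (lam = 0 → κ = 1) ∧
      -- endpoint condition
      (∃ a ∈ limitingSubdiff (EQ := EQ) (φ (Fin.last n)) (stateSeq F q₀ u (Fin.last n)),
        -p (Fin.last n) =
          lam • dCovector EQ ℓ (stateSeq F q₀ u (Fin.last n)) + κ • a) ∧
      -- adjoint equation, at the indices `1 ≤ i ≤ n - 1`
      (∀ i : Fin n, 0 < (i : ℕ) →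
        ∃ a ∈ limitingSubdiff (EQ := EQ) (φ i.castSucc) (stateSeq F q₀ u i.castSucc),
          -p i.castSucc
              + pullbackCovector (fun q => F i q (u i)) (stateSeq F q₀ u i.castSucc) (p i.succ) =
            lam • dCovector EQ (fun q => L i q (u i)) (stateSeq F q₀ u i.castSucc) + κ • a) ∧
      -- maximum condition; `p i.succ` is a covector at `q_{i+1} = F_i(q_i, u_i) = E(f_i(q_i, u_i))`
      (∀ i : Fin n, IsMaxOn
        (fun v => hamiltonian E (f i) (L i) (stateSeq F q₀ u i.castSucc) (u i) lam v (p i.succ))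
        (C i) (u i)) ∧
      -- nontriviality; `p 0` plays no role
      (lam = 1 ∨ ∃ i : Fin n, p i.succ ≠ 0) := by
  have hCU' : ∀ i, C i ⊆ U i := fun i => by
    obtain ⟨D, -, hD⟩ := hCU i
    exact hD ▸ inter_subset_left
  have hClc : ∀ i, IsLocallyClosed (C i) := fun i => by
    obtain ⟨D, hDc, hD⟩ := hCU i
    exact hD ▸ (hU i).inter hDc.isLocallyClosed
  have huC : ∀ i, u i ∈ C i := hu.1
  have huC' : u ∈ univ.pi C := fun i _ => huC i
  obtain ⟨lam, κ, a, hlam, hκ, hlamκ, ha, hne, hineq⟩ := exists_multipliers (g := g)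
    (φ := fun i : Fin n => φ i.succ) (fun i => (hφ i).continuous) hφ_nonneg
    (convex_pi fun i _ => hC i) huC' (eventually_isCompact_pi_inter_closedBall hClc huC')
    (q := fun i u => stateSeq F q₀ u i.succ) (fun i => contMDiffOn_stateSeq hCU' hF q₀ i.succ)
    (contDiffOn_totalCost hCU' hF q₀ hℓ hL) hu.2
    (fun v hv hv' => hmin ⟨fun i => hv i trivial, hv'⟩) hreg
  have hFd : ∀ (j : Fin n) (q : Q),
      MDifferentiableAt 𝓘(ℝ, EQ) 𝓘(ℝ, EQ) (fun q => F j q (u j)) q := fun j q =>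
    ((hF j).comp_contMDiff (contMDiff_id.prodMk contMDiff_const)
      fun q => ⟨trivial, hCU' j (huC j)⟩).mdifferentiable (by simp) q
  have hLd : ∀ (j : Fin n) (q : Q),
      MDifferentiableAt 𝓘(ℝ, EQ) 𝓘(ℝ, ℝ) (fun q => L j q (u j)) q := fun j q =>
    ((hL j).comp_contMDiff (contMDiff_id.prodMk contMDiff_const)
      fun q => ⟨trivial, hCU' j (huC j)⟩).mdifferentiable (by simp) q
  let A : ∀ j : Fin (n + 1), Covector EQ (stateSeq F q₀ u j) := Fin.cases 0 a
  have hA : ∀ j : Fin (n + 1), 0 < (j : ℕ) → A j ∈ limitingSubdiff (φ j) (stateSeq F q₀ u j) :=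
    fun j => Fin.cases (fun h => absurd h (lt_irrefl 0)) (fun i _ => ha i) j
  let p : ∀ j : Fin (n + 1), Covector EQ (stateSeq F q₀ u j) :=
    Fin.reverseInduction (motive := fun j => Covector EQ (stateSeq F q₀ u j))
      (-(lam • dCovector EQ ℓ (stateSeq F q₀ u (Fin.last n)) + κ • A (Fin.last n)))
      (fun j pj => pullbackCovector (fun q => F j q (u j)) (stateSeq F q₀ u j.castSucc) pj -
        (lam • dCovector EQ (fun q => L j q (u j)) (stateSeq F q₀ u j.castSucc) +
          κ • A j.castSucc))
  have hplast : -p (Fin.last n) =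
      lam • dCovector EQ ℓ (stateSeq F q₀ u (Fin.last n)) + κ • A (Fin.last n) := by
    simp only [p, Fin.reverseInduction_last, neg_neg]
  have hpadj : ∀ j : Fin n, -p j.castSucc +
      pullbackCovector (fun q => F j q (u j)) (stateSeq F q₀ u j.castSucc) (p j.succ) =
      lam • dCovector EQ (fun q => L j q (u j)) (stateSeq F q₀ u j.castSucc) +
        κ • A j.castSucc := by
    intro j
    have h : p j.castSucc =
        pullbackCovector (fun q => F j q (u j)) (stateSeq F q₀ u j.castSucc) (p j.succ) -
        (lam • dCovector EQ (fun q => L j q (u j)) (stateSeq F q₀ u j.castSucc) +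
          κ • A j.castSucc) := by
      simp only [p, Fin.reverseInduction_castSucc]
    rw [h]
    abel
  refine ⟨lam, κ, p, hlam, hκ, hlamκ, ⟨A (Fin.last n), hA _ (by simpa using hn), hplast⟩,
    fun i hi => ⟨A i.castSucc, hA _ hi, hpadj i⟩, fun i v hv => ?_, ?_⟩
  · set q := stateSeq F q₀ u i.castSucc with hqdef
    let γ : ℝ → ∀ j, EuclideanSpace ℝ (Fin (k j)) := fun t => u + t • (Function.update u i v - u)
    have hγ : ∀ t, ∀ j ≠ i, γ t j = u j := fun t j hj => by simp [γ, hj]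
    have hγi : ∀ t, γ t i = (1 - t) • u i + t • v := fun t => by
      simp only [γ, Pi.add_apply, Pi.smul_apply, Pi.sub_apply, Function.update_self]
      module
    have hγiC : ∀ t ∈ Icc (0 : ℝ) 1, (1 - t) • u i + t • v ∈ C i := fun t ht =>
      hC i (huC i) hv (sub_nonneg.2 ht.2) ht.1 (sub_add_cancel 1 t)
    have hvC : Function.update u i v ∈ univ.pi C := fun j _ => by
      rcases eq_or_ne j i with rfl | hj
      · simpa using hv
      · simpa [hj] using huC j
    obtain ⟨D, hD⟩ := exists_fiberDeriv_eq hE (f i q (u i))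
    have hsucc : stateSeq F q₀ u i.succ = E ⟨q, f i q (u i)⟩ := hfac i q (u i) (huC i)
    -- As `f i q` is affine, the varied state is `E` along the line from `f i q (u i)` in the
    -- direction `f i q v - f i q (u i)`.
    have hη : HasInitialVelocity (EQ := EQ) (fun t => F i q (γ t i)) (stateSeq F q₀ u i.succ)
        (fiberDeriv E (f i q (u i)) (f i q v - f i q (u i)) : EQ) := by
      have h1 := (hD (f i q v - f i q (u i))).2.hasInitialVelocity
      rw [hsucc]
      have h2 : E ⟨q, f i q (u i) + (0 : ℝ) • (f i q v - f i q (u i))⟩ =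
          E ⟨q, f i q (u i)⟩ := by rw [zero_smul, add_zero]
      rw [h2] at h1
      refine HasInitialVelocity.congr h1 fun t ht => ?_
      rw [hγi t, hfac i q _ (hγiC t ht), hf i q _ (huC i) _ hv t ht]
      congr 2
      module
    obtain ⟨ξ, hξ, hξ0, hξi, hξrec⟩ := exists_velocities (q₀ := q₀) hFd hγ hη
    obtain ⟨δ, hδ⟩ : ∃ δ, HasDerivWithinAt (fun t : ℝ => L i q ((1 - t) • u i + t • v)) δ
        (Icc 0 1) 0 := by
      have h1 : ContMDiff 𝓘(ℝ, ℝ) (𝓘(ℝ, EQ).prod 𝓘(ℝ, EuclideanSpace ℝ (Fin (k i)))) 1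
          fun t : ℝ => (q, (1 - t) • u i + t • v) := by
        refine contMDiff_const.prodMk (ContDiff.contMDiff ?_)
        fun_prop
      have h2 := ((hL i).comp h1.contMDiffOn fun t ht => ⟨trivial, hCU' i (hγiC t ht)⟩).contDiffOn
      exact ⟨_, (h2.differentiableOn (by simp) 0 (by simp)).hasDerivWithinAt⟩
    have hδle := (hLconv i q).deriv_line_le (huC i) hv hδ
    let dL : Fin n → EQ →L[ℝ] ℝ := fun j =>
      dCovector EQ (fun q => L j q (u j)) (stateSeq F q₀ u j.castSucc)
    let dl : EQ →L[ℝ] ℝ := dCovector EQ ℓ (stateSeq F q₀ u (Fin.last n))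
    -- The running cost at time `i` feels the control alone, since the state there has not moved
    -- yet; at all other times only the state moves.
    have hJ : HasDerivWithinAt (fun t : ℝ => totalCost F q₀ ℓ L (γ t))
        (dl (ξ (Fin.last n)) + ∑ j, (dL j (ξ j.castSucc) + if j = i then δ else 0))
        (Icc 0 1) 0 := by
      refine ((hξ (Fin.last n)).hasDerivWithinAt_comp
        (hℓ.mdifferentiable (by simp) _)).add (HasDerivWithinAt.fun_sum fun j _ => ?_)
      rcases eq_or_ne j i with rfl | hj
      · have h1 : dL j (ξ j.castSucc) + (if j = j then δ else 0) = δ := by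
          simp [hξ0 j.castSucc le_rfl]
        rw [h1]
        refine hδ.congr_of_mem (fun t ht => ?_) (by simp)
        rw [hγi t, stateSeq_congr (u' := u) j.castSucc fun l hl => hγ t l fun h => by
          subst h; exact lt_irrefl _ hl]
      · rw [if_neg hj, add_zero]
        have h1 := (hξ j.castSucc).hasDerivWithinAt_comp (hLd j _)
        simp only [hγ _ j hj]
        exact h1
    have h0 := hineq _ hvC _ (fun j => ξ j.succ) hJ (fun j => hξ j.succ)
    have hpi := adjoint_apply_variation (V := EQ) (P := p) (A := A)
      (T := fun j => mfderiv 𝓘(ℝ, EQ) 𝓘(ℝ, EQ) (fun q => F j q (u j))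
        (stateSeq F q₀ u j.castSucc)) (dL := dL) (dl := dl) (ξ := ξ) (i := i) hplast
      (fun j _ => hpadj j) hξ0 hξrec
    rw [Finset.sum_add_distrib, Finset.sum_ite_eq' Finset.univ i, if_pos (Finset.mem_univ i)] at h0
    let pe : EQ →L[ℝ] ℝ := p i.succ
    have hsplit : pe (ξ i.succ) = pe (fiberDeriv E (f i q (u i)) (f i q v) : EQ) -
        pe (fiberDeriv E (f i q (u i)) (f i q (u i)) : EQ) := by
      rw [hξi, (hD _).1, (hD (f i q v)).1, (hD (f i q (u i))).1, map_sub]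
      exact map_sub pe _ _
    have hlam0 : 0 ≤ lam := by rcases hlam with rfl | rfl <;> norm_num
    -- Summation by parts identifies the left side with minus all terms of the multiplier inequality
    -- except `lam * δ`.
    have hle : pe (ξ i.succ) ≤ lam * δ := by
      have h1 : pe (ξ i.succ) = -(lam * (∑ j, dL j (ξ j.castSucc) + dl (ξ (Fin.last n))) +
        κ * ∑ j : Fin n, a j (ξ j.succ)) := hpi
      rw [h1]
      linarith
    have hfin : pe (fiberDeriv E (f i q (u i)) (f i q v) : EQ) - lam * L i q v ≤
        pe (fiberDeriv E (f i q (u i)) (f i q (u i)) : EQ) - lam * L i q (u i) := by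
      have := mul_le_mul_of_nonneg_left hδle hlam0
      linarith
    exact hfin
  · rcases hne with h1 | ⟨i, hi⟩
    · exact .inl h1
    · refine hlam.symm.imp_right fun h0 => ?_
      by_contra! hp0
      -- With `lam = 0` and `κ = 1`, vanishing costates reduce the adjoint equation, or the endpoint
      -- condition at the last index, to the vanishing of the multiplier.
      have hAi : A i.succ = 0 := by
        have hκ1 := hlamκ h0
        rcases Fin.eq_castSucc_or_eq_last i.succ with ⟨j, hj⟩ | hj
        · have h1 := hpadj j
          have h2 : p j.castSucc = 0 := hj ▸ hp0 i
          rw [h2, hp0 j, h0, hκ1, zero_smul, one_smul, zero_add, neg_zero, zero_add] at h1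
          have h3 : A j.castSucc = 0 := h1.symm.trans (ContinuousLinearMap.zero_comp _)
          exact hj ▸ h3
        · have h2 : p (Fin.last n) = 0 := hj ▸ hp0 i
          have h1 := hplast
          rw [h2, h0, hκ1, zero_smul, one_smul, zero_add, neg_zero] at h1
          exact hj ▸ h1.symm
      exact hi hAi
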